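/- Let $\mathbb K=\mathbb R$ or $\mathbb C$, and let $\mathfrak g=\mathfrak g_0\oplus\mathfrak g_1$ be a Lie superalgebra over $\mathbb K$ with a basis $X_1,\dots,X_n$ of $\mathfrak g_0$ and a basis $\theta_1,\dots,\theta_m$ of $\mathfrak g_1$ such that $$[X_\mu,X_\nu]=\sum_{\alpha}C_{\mu\nu\alpha}X_\alpha,\qquad [\theta_a,X_\nu]=\sum_b K_{a\nu b}\,\theta_b,\qquad [\theta_a,\theta_b]=0 .$$ Let $\mathfrak g^L$ be the vector space with basis $X_\mu,\theta_a,T^1_{\mu\nu},T^2_{\mu a},T^4_{ab}$ ($1\le\mu,\nu\le n$, $1\le a,b\le m$), where $X_\mu,T^1_{\mu\nu},T^4_{ab}$ are even and $\theta_a,T^2_{\mu a}$ are odd, with the graded skew-symmetric bracket that is given on $X_\mu,\theta_a$ by the formulas above and otherwise by $$[T^1_{\mu\nu},X_\lambda]=\sum_\rho C_{\mu\lambda\rho}T^1_{\rho\nu},\quad [T^1_{\mu\nu},\theta_a]=0,\quad [T^2_{\mu a},X_\lambda]=\sum_\rho C_{\mu\lambda\rho}T^2_{\rho a},\quad [T^2_{\mu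 a},\theta_b]=-\sum_c K_{b\mu c}T^4_{ca},$$ $$[T^4_{ab},X_\lambda]=\sum_c K_{a\lambda c}T^4_{cb},\quad [T^4_{ab},\theta_c]=0,\quad [T,T']=0\ \text{ for any two of the basis elements } T^1_{\mu\nu},T^2_{\mu a},T^4_{ab}.$$ Let $\hat{\mathcal A}_{(n,m)}$ be the semicompleted Weyl superalgebra: it has even generators $x_\mu,\partial_\mu$ ($1\le\mu\le n$) and odd generators $\xi_a,q_a$ ($1\le a\le m$) with supercommutators $[\partial_\mu,x_\nu]=\delta_{\mu\nu}$, $[q_a,\xi_b]=\delta_{ab}$, all other supercommutators of generators being zero, and it contains formal power series in the $\partial_\mu$ and $q_a$ but only polynomials in the $x_\mu$ and $\xi_a$. Put $\psi(t)=\frac{t}{1-e^{-t}}$, $\mathbb C_{\mu\nu}=\sum_\alpha C_{\mu\alpha\nu}\partial_\alpha$, $\mathbb K_{ab}=\sum_\rho K_{a\rho b}\partial_\rho$, and let $\varphi:\mathfrak g^L\to\hat{\mathcal A}_{(n,m)}$ be the linear map with $$\varphi(X_\mu)=\sum_\alpha x_\alpha\,\psi(\mathbb C)_{\mu\alpha}-\sum_{a,b}K_{b\mu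 a}\,\xi_a q_b,\qquad \varphi(\theta_a)=\xi_a,$$ $$\varphi(T^1_{\mu\nu})=(e^{\mathbb C})_{\mu\nu},\qquad \varphi(T^2_{\mu a})=-\sum_{b,c}K_{b\mu c}\,(e^{\mathbb K})_{ca}\,q_b,\qquad \varphi(T^4_{ab})=(e^{\mathbb K})_{ab}.$$ Then $\mathfrak g^L$ is a Lie superalgebra and $\varphi$ is a realization of it: $\varphi$ preserves degrees, and $\varphi([u,v])=\varphi(u)\varphi(v)-(-1)^{\bar u\bar v}\varphi(v)\varphi(u)$ for all homogeneous $u,v\in\mathfrak g^L$. -/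

import Mathlib

noncomputable section

open scoped TensorProduct

/-! ### Lie superalgebras -/

/-- The space `V = V₀ ⊕ V₁` with the bilinear bracket `br` is a Lie superalgebra. -/
structure IsLieSuperalgebra {K V : Type*} [Field K] [AddCommGroup V] [Module K V]
    (V' : ZMod 2 → Submodule K V) (br : V →ₗ[K] V →ₗ[K] V) : Prop where
  isInternal : DirectSum.IsInternal V'
  bracket_mem : ∀ i j, ∀ x ∈ V' i, ∀ y ∈ V' j, br x y ∈ V' (i + j)
  skew : ∀ i j, ∀ x ∈ V' i, ∀ y ∈ V' j, br x y = -((-1 : K) ^ (i.val * j.val) • br y x)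
  jacobi : ∀ i j k, ∀ x ∈ V' i, ∀ y ∈ V' j, ∀ z ∈ V' k,
    (-1 : K) ^ (i.val * k.val) • br x (br y z) + (-1 : K) ^ (j.val * i.val) • br y (br z x) +
      (-1 : K) ^ (k.val * j.val) • br z (br x y) = 0

/-- A linear map `φ` from `V = V₀ ⊕ V₁`, with bracket `br`, to an associative superalgebra
`A = A₀ ⊕ A₁` is a realization: it preserves degrees and takes the bracket to the supercommutator
`[a, b] = a b - (-1)^{|a| |b|} b a`. -/
structure IsRealization {K V A : Type*} [Field K] [AddCommGroup V] [Module K V] [Ring A]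
    [Algebra K A] (V' : ZMod 2 → Submodule K V) (br : V →ₗ[K] V →ₗ[K] V)
    (A' : ZMod 2 → Submodule K A) (φ : V →ₗ[K] A) : Prop where
  map_mem : ∀ i, ∀ u ∈ V' i, φ u ∈ A' i
  map_bracket : ∀ i j, ∀ u ∈ V' i, ∀ v ∈ V' j,
    φ (br u v) = φ u * φ v - (-1 : K) ^ (i.val * j.val) • (φ v * φ u)

/-! ### The extension `g^L` by the left shift operators -/

/-- The basis of `g^L`: `X_μ`, `θ_a`, `T¹_{μν}`, `T²_{μa}`, `T⁴_{ab}`. -/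
inductive ShiftBasis (n m : ℕ) : Type
  | X (μ : Fin n)
  | θ (a : Fin m)
  | T1 (μ ν : Fin n)
  | T2 (μ : Fin n) (a : Fin m)
  | T4 (a b : Fin m)

namespace ShiftBasis

variable {n m : ℕ} {K : Type*} [Field K]

/-- The degrees of the basis elements. -/
def parity : ShiftBasis n m → ZMod 2
  | X _ => 0
  | θ _ => 1
  | T1 _ _ => 0
  | T2 _ _ => 1
  | T4 _ _ => 0

/-- The brackets of the basis elements of `g^L`, for structure constants `C` and `k`. -/
def table (C : Fin n → Fin n → Fin n → K) (k : Fin m → Fin n → Fin m → K) :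
    ShiftBasis n m → ShiftBasis n m → (ShiftBasis n m →₀ K)
  | X μ, X ν => ∑ α, Finsupp.single (X α) (C μ ν α)
  | θ a, X ν => ∑ b, Finsupp.single (θ b) (k a ν b)
  | X ν, θ a => -∑ b, Finsupp.single (θ b) (k a ν b)
  | θ _, θ _ => 0
  | T1 μ ν, X lam => ∑ ρ, Finsupp.single (T1 ρ ν) (C μ lam ρ)
  | X lam, T1 μ ν => -∑ ρ, Finsupp.single (T1 ρ ν) (C μ lam ρ)
  | T1 _ _, θ _ => 0
  | θ _, T1 _ _ => 0
  | T2 μ a, X lam => ∑ ρ, Finsupp.single (T2 ρ a) (C μ lam ρ)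
  | X lam, T2 μ a => -∑ ρ, Finsupp.single (T2 ρ a) (C μ lam ρ)
  | T2 μ a, θ b => -∑ c, Finsupp.single (T4 c a) (k b μ c)
  | θ b, T2 μ a => -∑ c, Finsupp.single (T4 c a) (k b μ c)
  | T4 a b, X lam => ∑ c, Finsupp.single (T4 c b) (k a lam c)
  | X lam, T4 a b => -∑ c, Finsupp.single (T4 c b) (k a lam c)
  | T4 _ _, θ _ => 0
  | θ _, T4 _ _ => 0
  | T1 _ _, T1 _ _ => 0
  | T1 _ _, T2 _ _ => 0
  | T1 _ _, T4 _ _ => 0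
  | T2 _ _, T1 _ _ => 0
  | T2 _ _, T2 _ _ => 0
  | T2 _ _, T4 _ _ => 0
  | T4 _ _, T1 _ _ => 0
  | T4 _ _, T2 _ _ => 0
  | T4 _ _, T4 _ _ => 0

end ShiftBasis

/-- The space `g^L`, with basis `ShiftBasis n m`. -/
abbrev ShiftExt (n m : ℕ) (K : Type*) [Field K] : Type _ := ShiftBasis n m →₀ K

namespace ShiftExt

variable {n m : ℕ} {K : Type*} [Field K]

/-- The even and the odd part of `g^L`. -/
def grading (n m : ℕ) (K : Type*) [Field K] (i : ZMod 2) : Submodule K (ShiftExt n m K) :=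
  Finsupp.supported K K {e | e.parity = i}

/-- The superbracket of `g^L`. -/
def bracket (C : Fin n → Fin n → Fin n → K) (k : Fin m → Fin n → Fin m → K) :
    ShiftExt n m K →ₗ[K] ShiftExt n m K →ₗ[K] ShiftExt n m K :=
  Finsupp.linearCombination K fun u =>
    Finsupp.linearCombination K fun v => ShiftBasis.table C k u v

end ShiftExt

/-! ### The semicompleted Weyl algebra -/

/-- Formal power series in the commuting variables `∂_1, …, ∂_n`. -/
abbrev DSeries (n : ℕ) (K : Type*) [Field K] : Type _ := MvPowerSeries (Fin n) K

/-- Normally ordered expressions `∑ x^β f_β(∂)`: polynomials in `x_1, …, x_n`, written on the left,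
with coefficients that are formal power series in `∂_1, …, ∂_n`. The product of this ring
`MvPolynomial (Fin n) (DSeries n K)` is the commutative one. -/
abbrev NormalOrdered (n : ℕ) (K : Type*) [Field K] : Type _ := MvPolynomial (Fin n) (DSeries n K)

namespace NormalOrdered

variable {n : ℕ} {K : Type*} [Field K]

/-- `∑ x^β f_β(∂) ↦ ∑ x^β (∂f_β/∂∂_i)(∂)`. -/
def derivD (i : Fin n) : NormalOrdered n K →ₗ[K] NormalOrdered n K where
  toFun := AddMonoidAlgebra.map
    (MvPowerSeries.pderiv K i : DSeries n K →ₗ[K] DSeries n K).toAddMonoidHom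
  map_add' F G := by
    ext β : 1
    exact map_add (MvPowerSeries.pderiv K i) _ _
  map_smul' c F := by
    ext β : 1
    exact (MvPowerSeries.pderiv K i : DSeries n K →ₗ[K] DSeries n K).map_smul c _

theorem coeff_derivD (i : Fin n) (F : NormalOrdered n K) (β : Fin n →₀ ℕ) :
    (derivD i F).coeff β = MvPowerSeries.pderiv K i (F.coeff β) := rfl

/-- Right multiplication by `x_i` in the Weyl algebra, in normal order:
since `f(∂) x_i = x_i f(∂) + (∂f/∂∂_i)(∂)`, it is `F ↦ x_i F + ∂F/∂∂_i`. -/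
def rightX (i : Fin n) : Module.End K (NormalOrdered n K) :=
  LinearMap.mulLeft K (MvPolynomial.X i) + derivD i

theorem pderiv_comm (i j : Fin n) (f : DSeries n K) :
    MvPowerSeries.pderiv K i (MvPowerSeries.pderiv K j f) =
      MvPowerSeries.pderiv K j (MvPowerSeries.pderiv K i f) := by
  ext d
  simp only [MvPowerSeries.coeff_pderiv]
  by_cases h : i = j
  · subst h; rfl
  · simp [h, Ne.symm h, add_right_comm]
    ring

theorem derivD_comm (i j : Fin n) (F : NormalOrdered n K) :
    derivD i (derivD j F) = derivD j (derivD i F) := by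
  ext β : 1
  simp only [coeff_derivD, pderiv_comm]

theorem derivD_mul (i : Fin n) (F G : NormalOrdered n K) :
    derivD i (F * G) = derivD i F * G + F * derivD i G := by
  ext β : 1
  simp only [coeff_derivD, MvPolynomial.coeff_mul, MvPolynomial.coeff_add, map_sum,
    Derivation.leibniz, smul_eq_mul, ← Finset.sum_add_distrib]
  refine Finset.sum_congr rfl fun p _ => ?_
  ring

theorem derivD_monomial (i : Fin n) (β : Fin n →₀ ℕ) (g : DSeries n K) :
    derivD i (MvPolynomial.monomial β g) =
      MvPolynomial.monomial β (MvPowerSeries.pderiv K i g) := by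
  ext γ : 1
  rw [coeff_derivD, MvPolynomial.coeff_monomial, MvPolynomial.coeff_monomial]
  split_ifs <;> simp

theorem derivD_monomial_one (i : Fin n) (β : Fin n →₀ ℕ) :
    derivD i (MvPolynomial.monomial β 1 : NormalOrdered n K) = 0 := by
  rw [derivD_monomial]
  simp

theorem derivD_X (i j : Fin n) : derivD i (MvPolynomial.X j : NormalOrdered n K) = 0 :=
  derivD_monomial_one i _

theorem derivD_C (i : Fin n) (f : DSeries n K) :
    derivD i (MvPolynomial.C f) = MvPolynomial.C (MvPowerSeries.pderiv K i f) :=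
  derivD_monomial i 0 f

theorem rightX_apply (i : Fin n) (F : NormalOrdered n K) :
    rightX i F = MvPolynomial.X i * F + derivD i F := rfl

theorem rightX_commute (i j : Fin n) : Commute (rightX (K := K) i) (rightX j) := by
  refine LinearMap.ext fun F => ?_
  simp only [Module.End.mul_apply, rightX_apply, map_add, derivD_mul, derivD_X, derivD_comm i j F]
  ring

theorem rightX_pairwise (β : Fin n →₀ ℕ) :
    ((Finset.univ : Finset (Fin n)) : Set (Fin n)).Pairwise
      (Function.onFun Commute fun i => rightX (K := K) i ^ β i) :=
  fun i _ j _ _ => (rightX_commute i j).pow_pow _ _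

/-- Right multiplication by `x^β` in the Weyl algebra, in normal order. -/
def rightMonomial (β : Fin n →₀ ℕ) : Module.End K (NormalOrdered n K) :=
  Finset.univ.noncommProd (fun i => rightX i ^ β i) (rightX_pairwise β)

theorem rightMonomial_add (β γ : Fin n →₀ ℕ) :
    rightMonomial (K := K) (β + γ) = rightMonomial β * rightMonomial γ := by
  rw [rightMonomial, rightMonomial, rightMonomial, ← Finset.noncommProd_mul_distrib]
  · refine Finset.noncommProd_congr rfl (fun j _ => ?_) _
    simp [pow_add]
  · exact fun i _ j _ _ => (rightX_commute i j).pow_pow _ _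

theorem rightMonomial_single (i : Fin n) (d : ℕ) :
    rightMonomial (K := K) (Finsupp.single i d) = rightX i ^ d := by
  have h : ∀ j ∈ Finset.univ.erase i, rightX (K := K) j ^ (Finsupp.single i d) j = 1 := by
    intro j hj
    simp [(Finset.ne_of_mem_erase hj).symm]
  refine (Finset.noncommProd_erase_mul _ (Finset.mem_univ i) _ (rightX_pairwise _)).symm.trans ?_
  refine (congrArg (· * _) (Finset.noncommProd_eq_pow_card _ _ _ 1 h)).trans ?_
  simp

theorem rightMonomial_zero : rightMonomial (K := K) (0 : Fin n →₀ ℕ) = 1 := by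
  rw [rightMonomial, Finset.noncommProd_eq_pow_card (m := 1)]
  · simp
  · simp

/-- The product of the Weyl algebra, in normal order: `F · ∑ x^β g_β(∂) = ∑ (F · x^β) g_β(∂)`. -/
def wmul (F G : NormalOrdered n K) : NormalOrdered n K :=
  ∑ β ∈ G.support, rightMonomial β F * MvPolynomial.C (G.coeff β)

theorem wmul_eq_sum_of_subset (F G : NormalOrdered n K) (s : Finset (Fin n →₀ ℕ))
    (h : G.support ⊆ s) :
    wmul F G = ∑ β ∈ s, rightMonomial β F * MvPolynomial.C (G.coeff β) := by
  refine Finset.sum_subset h fun β _ hβ => ?_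
  rw [MvPolynomial.notMem_support_iff.1 hβ, map_zero, mul_zero]

theorem wmul_add (F G H : NormalOrdered n K) : wmul F (G + H) = wmul F G + wmul F H := by
  classical
  rw [wmul_eq_sum_of_subset F (G + H) (G.support ∪ H.support) MvPolynomial.support_add,
    wmul_eq_sum_of_subset F G (G.support ∪ H.support) Finset.subset_union_left,
    wmul_eq_sum_of_subset F H (G.support ∪ H.support) Finset.subset_union_right,
    ← Finset.sum_add_distrib]
  simp [mul_add]

theorem add_wmul (F G H : NormalOrdered n K) : wmul (F + G) H = wmul F H + wmul G H := by
  simp [wmul, add_mul, Finset.sum_add_distrib]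

theorem zero_wmul (H : NormalOrdered n K) : wmul 0 H = 0 := by
  simp [wmul]

theorem wmul_zero (H : NormalOrdered n K) : wmul H 0 = 0 := by
  simp [wmul]

theorem smul_wmul (c : K) (F G : NormalOrdered n K) : wmul (c • F) G = c • wmul F G := by
  simp [wmul, Finset.smul_sum]

theorem wmul_monomial (F : NormalOrdered n K) (β : Fin n →₀ ℕ) (g : DSeries n K) :
    wmul F (MvPolynomial.monomial β g) = rightMonomial β F * MvPolynomial.C g := by
  rw [wmul_eq_sum_of_subset F _ {β} MvPolynomial.support_monomial_subset]
  simp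

theorem wmul_C (F : NormalOrdered n K) (g : DSeries n K) :
    wmul F (MvPolynomial.C g) = F * MvPolynomial.C g := by
  have h := wmul_monomial F 0 g
  rwa [rightMonomial_zero] at h

theorem wmul_X (F : NormalOrdered n K) (i : Fin n) :
    wmul F (MvPolynomial.X i) = MvPolynomial.X i * F + derivD i F := by
  have h := wmul_monomial F (Finsupp.single i 1) 1
  rwa [rightMonomial_single, pow_one, MvPolynomial.C_1, mul_one] at h

theorem wmul_smul (c : K) (F G : NormalOrdered n K) : wmul F (c • G) = c • wmul F G := by
  have h : ∀ g : DSeries n K, (MvPolynomial.C (c • g) : NormalOrdered n K) =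
      c • MvPolynomial.C g := fun g => by
    ext β : 1
    rw [MvPolynomial.coeff_smul, MvPolynomial.coeff_C, MvPolynomial.coeff_C]
    split_ifs <;> simp
  rw [wmul_eq_sum_of_subset F (c • G) G.support MvPolynomial.support_smul, wmul, Finset.smul_sum]
  refine Finset.sum_congr rfl fun β _ => ?_
  rw [MvPolynomial.coeff_smul, h, mul_smul_comm]

theorem wmul_mul_C (F G : NormalOrdered n K) (g : DSeries n K) :
    wmul F (G * MvPolynomial.C g) = wmul F G * MvPolynomial.C g := by
  induction G using MvPolynomial.induction_on' with
  | monomial β f =>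
    rw [mul_comm, MvPolynomial.C_mul_monomial, wmul_monomial, wmul_monomial, mul_comm g, map_mul,
      mul_assoc]
  | add p q hp hq => rw [add_mul, wmul_add, wmul_add, hp, hq, add_mul]

theorem wmul_rightX (i : Fin n) (F G : NormalOrdered n K) :
    wmul F (rightX i G) = rightX i (wmul F G) := by
  induction G using MvPolynomial.induction_on' with
  | monomial β g =>
    rw [rightX_apply, wmul_add, derivD_monomial, wmul_monomial, wmul_monomial, MvPolynomial.X,
      MvPolynomial.monomial_mul, one_mul, wmul_monomial, rightMonomial_add, rightMonomial_single,
      pow_one, Module.End.mul_apply, rightX_apply, rightX_apply, derivD_mul, derivD_C]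
    ring
  | add p q hp hq => rw [map_add, wmul_add, wmul_add, map_add, hp, hq]

theorem wmul_rightMonomial (β : Fin n →₀ ℕ) (F G : NormalOrdered n K) :
    wmul F (rightMonomial β G) = rightMonomial β (wmul F G) := by
  induction β using Finsupp.induction_linear generalizing G with
  | zero => simp [rightMonomial_zero]
  | add β γ hβ hγ =>
    rw [rightMonomial_add, Module.End.mul_apply, Module.End.mul_apply, hβ, hγ]
  | single i d =>
    rw [rightMonomial_single]
    induction d with
    | zero => simp
    | succ d ih =>
      rw [pow_succ', Module.End.mul_apply, Module.End.mul_apply, wmul_rightX, ih]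

theorem wmul_assoc (F G H : NormalOrdered n K) : wmul (wmul F G) H = wmul F (wmul G H) := by
  induction H using MvPolynomial.induction_on' with
  | monomial β g => rw [wmul_monomial, wmul_monomial, wmul_mul_C, wmul_rightMonomial]
  | add p q hp hq => rw [wmul_add, wmul_add, wmul_add, hp, hq]

theorem rightMonomial_monomial (β γ : Fin n →₀ ℕ) :
    rightMonomial (K := K) β (MvPolynomial.monomial γ 1) = MvPolynomial.monomial (β + γ) 1 := by
  induction β using Finsupp.induction_linear generalizing γ with
  | zero => simp [rightMonomial_zero]
  | add β δ hβ hδ => rw [rightMonomial_add, Module.End.mul_apply, hδ, hβ, add_assoc]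
  | single i d =>
    rw [rightMonomial_single]
    induction d with
    | zero => simp
    | succ d ih =>
      rw [pow_succ', Module.End.mul_apply, ih, rightX_apply, derivD_monomial_one, add_zero,
        MvPolynomial.X, MvPolynomial.monomial_mul, one_mul, ← add_assoc, ← Finsupp.single_add,
        add_comm 1 d]

theorem wmul_one (F : NormalOrdered n K) : wmul F 1 = F := by
  have h := wmul_C F 1
  rwa [map_one, mul_one] at h

theorem one_wmul (G : NormalOrdered n K) : wmul 1 G = G := by
  induction G using MvPolynomial.induction_on' with
  | monomial β g =>
    rw [wmul_monomial, ← MvPolynomial.C_1, MvPolynomial.C_apply, rightMonomial_monomial, add_zero,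
      mul_comm, MvPolynomial.C_mul_monomial, mul_one]
  | add p q hp hq => rw [wmul_add, hp, hq]

end NormalOrdered

/-- The semicompleted Weyl algebra: power series in `∂_1, …, ∂_n`, polynomials in `x_1, …, x_n`,
subject to `[∂_μ, x_ν] = δ_{μν}`, each element being given by its normally ordered form. -/
structure SemiWeyl (n : ℕ) (K : Type*) [Field K] where
  /-- The element with a given normally ordered form. -/
  ofNormal ::
  /-- The normally ordered form. -/
  normal : NormalOrdered n K

namespace SemiWeyl

variable {n : ℕ} {K : Type*} [Field K]

theorem normal_injective : Function.Injective (normal : SemiWeyl n K → NormalOrdered n K) :=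
  fun F G h => by
    cases F
    cases G
    exact congrArg ofNormal h

instance : Zero (SemiWeyl n K) := ⟨ofNormal 0⟩
instance : One (SemiWeyl n K) := ⟨ofNormal 1⟩
instance : Add (SemiWeyl n K) := ⟨fun F G => ofNormal (F.normal + G.normal)⟩
instance : Neg (SemiWeyl n K) := ⟨fun F => ofNormal (-F.normal)⟩
instance : Sub (SemiWeyl n K) := ⟨fun F G => ofNormal (F.normal - G.normal)⟩
instance {R : Type*} [SMul R (NormalOrdered n K)] : SMul R (SemiWeyl n K) :=
  ⟨fun c F => ofNormal (c • F.normal)⟩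
instance : Mul (SemiWeyl n K) := ⟨fun F G => ofNormal (NormalOrdered.wmul F.normal G.normal)⟩

instance instAddCommGroup : AddCommGroup (SemiWeyl n K) :=
  normal_injective.addCommGroup normal rfl (fun _ _ => rfl) (fun _ => rfl) (fun _ _ => rfl)
    (fun _ _ => rfl) (fun _ _ => rfl)

instance : Ring (SemiWeyl n K) :=
  { instAddCommGroup with
    mul_assoc := fun F G H => normal_injective (NormalOrdered.wmul_assoc _ _ _)
    one_mul := fun F => normal_injective (NormalOrdered.one_wmul _)
    mul_one := fun F => normal_injective (NormalOrdered.wmul_one _)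
    left_distrib := fun F G H => normal_injective (NormalOrdered.wmul_add _ _ _)
    right_distrib := fun F G H => normal_injective (NormalOrdered.add_wmul _ _ _)
    zero_mul := fun F => normal_injective (NormalOrdered.zero_wmul F.normal)
    mul_zero := fun F => normal_injective (NormalOrdered.wmul_zero F.normal) }

instance : Module K (SemiWeyl n K) :=
  { one_smul := fun F => normal_injective (one_smul K F.normal)
    mul_smul := fun c d F => normal_injective (mul_smul c d F.normal)
    smul_zero := fun c => normal_injective (smul_zero c)
    smul_add := fun c F G => normal_injective (smul_add c F.normal G.normal)
    add_smul := fun c d F => normal_injective (add_smul c d F.normal)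
    zero_smul := fun F => normal_injective (zero_smul K F.normal) }

instance : Algebra K (SemiWeyl n K) :=
  Algebra.ofModule (fun c F G => normal_injective (NormalOrdered.smul_wmul c F.normal G.normal))
    (fun c F G => normal_injective (NormalOrdered.wmul_smul c F.normal G.normal))

/-- The element `x_μ`. -/
def x (μ : Fin n) : SemiWeyl n K := ofNormal (MvPolynomial.X μ)

/-- The element `f(∂)`. -/
def series (f : DSeries n K) : SemiWeyl n K := ofNormal (MvPolynomial.C f)

theorem series_mul (f g : DSeries n K) : series (f * g) = series f * series g :=
  normal_injective ((NormalOrdered.wmul_C _ g).trans (map_mul _ f g).symm).symm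

theorem x_mul_x (μ ν : Fin n) : (x μ * x ν : SemiWeyl n K) = x ν * x μ := by
  refine normal_injective ((NormalOrdered.wmul_X _ ν).trans
    (Eq.trans ?_ (NormalOrdered.wmul_X _ μ).symm))
  simp only [x, NormalOrdered.derivD_X, mul_comm]

theorem series_mul_x (f : DSeries n K) (μ : Fin n) :
    series f * x μ = x μ * series f + series (MvPowerSeries.pderiv K μ f) := by
  refine normal_injective ((NormalOrdered.wmul_X _ μ).trans ?_)
  rw [series, NormalOrdered.derivD_C]
  exact congrArg (· + _) (NormalOrdered.wmul_C _ f).symm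

end SemiWeyl

/-! ### The semicompleted Weyl superalgebra -/

/-- The Clifford algebra on `q_1, …, q_m, ξ_1, …, ξ_m`, for the quadratic form
`(∑ s_a q_a + ∑ t_a ξ_a)² = ∑ s_a t_a`. -/
abbrev CliffordPart (m : ℕ) (K : Type*) [Field K] : Type _ :=
  CliffordAlgebra (QuadraticForm.dualProd K (Fin m → K))

/-- The semicompleted Weyl superalgebra (Clifford-Weyl algebra): the `x_μ`, `∂_μ` commute with the
`ξ_a`, `q_a`. No completion in the `q_a` is needed: they anticommute and square to zero. -/
abbrev SemiWeylSuper (n m : ℕ) (K : Type*) [Field K] : Type _ :=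
  SemiWeyl n K ⊗[K] CliffordPart m K

namespace SemiWeylSuper

variable {n m : ℕ} {K : Type*} [Field K]

/-- The even and the odd part: `x_μ`, `∂_μ` are even, `ξ_a`, `q_a` are odd. -/
def grading (n m : ℕ) (K : Type*) [Field K] (i : ZMod 2) : Submodule K (SemiWeylSuper n m K) :=
  Submodule.span K {z | ∃ w : SemiWeyl n K,
    ∃ c ∈ CliffordAlgebra.evenOdd (QuadraticForm.dualProd K (Fin m → K)) i, z = w ⊗ₜ[K] c}

/-- The generator `x_μ`. -/
def x (μ : Fin n) : SemiWeylSuper n m K := SemiWeyl.x μ ⊗ₜ[K] 1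

/-- The element `f(∂)` for a formal power series `f`. -/
def series (f : DSeries n K) : SemiWeylSuper n m K := SemiWeyl.series f ⊗ₜ[K] 1

/-- The generator `ξ_a`. -/
def ξ (a : Fin m) : SemiWeylSuper n m K :=
  1 ⊗ₜ[K] CliffordAlgebra.ι (QuadraticForm.dualProd K (Fin m → K)) (0, Pi.single a 1)

/-- The generator `q_a`. -/
def q (a : Fin m) : SemiWeylSuper n m K :=
  1 ⊗ₜ[K] CliffordAlgebra.ι (QuadraticForm.dualProd K (Fin m → K)) (LinearMap.proj a, 0)

end SemiWeylSuper

/-! ### Power series of matrices, and the realization -/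

/-- `f(M) = ∑ f_j M^j` for a power series `f` in one variable and a square matrix `M` of power
series without constant terms: an entry of `M^j` has no terms of degree less than `j`, so that the
coefficient of a monomial `∂^d` in `f(M)` is a sum over `j ≤ |d|`. -/
def matrixSeries {n : ℕ} {K ι : Type*} [Field K] [Fintype ι] [DecidableEq ι]
    (f : PowerSeries K) (M : Matrix ι ι (DSeries n K)) : Matrix ι ι (DSeries n K) :=
  Matrix.of fun r s => fun d : Fin n →₀ ℕ =>
    ∑ j ∈ Finset.range (d.degree + 1), PowerSeries.coeff j f * MvPowerSeries.coeff d ((M ^ j) r s)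

/-- `ψ(t) = t / (1 - e^{-t}) = ∑ B_j (-1)^j t^j / j!`. -/
def psiSeries (K : Type*) [Field K] [CharZero K] : PowerSeries K :=
  PowerSeries.mk fun j => algebraMap ℚ K (bernoulli j * (-1) ^ j / j.factorial)

theorem psiSeries_mul (K : Type*) [Field K] [CharZero K] :
    psiSeries K * (1 - PowerSeries.evalNegHom (PowerSeries.exp K)) = PowerSeries.X := by
  have h0 : psiSeries K = bernoulli'PowerSeries K := by
    ext j
    simp [psiSeries, bernoulli'PowerSeries, bernoulli'_eq_bernoulli, mul_comm]
  have h := congrArg (· * PowerSeries.evalNegHom (PowerSeries.exp K))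
    (bernoulli'PowerSeries_mul_exp_sub_one K)
  simpa only [mul_assoc, sub_mul, PowerSeries.exp_mul_exp_neg_eq_one, one_mul, mul_one, ← h0]
    using h

section Realization

variable {n m : ℕ} {K : Type*} [Field K]

/-- The matrix `ℂ_{μν} = ∑_α C_{μαν} ∂_α`. -/
def matC (C : Fin n → Fin n → Fin n → K) : Matrix (Fin n) (Fin n) (DSeries n K) :=
  Matrix.of fun μ ν => ∑ α, C μ α ν • MvPowerSeries.X α

/-- The matrix `𝕂_{ab} = ∑_ρ K_{aρb} ∂_ρ`. -/
def matK (k : Fin m → Fin n → Fin m → K) : Matrix (Fin m) (Fin m) (DSeries n K) :=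
  Matrix.of fun a b => ∑ ρ, k a ρ b • MvPowerSeries.X ρ

variable [CharZero K]

/-- The images of the basis elements of `g^L`. -/
def weylLinearBasis (C : Fin n → Fin n → Fin n → K) (k : Fin m → Fin n → Fin m → K) :
    ShiftBasis n m → SemiWeylSuper n m K
  | .X μ => ∑ α, SemiWeylSuper.x α * SemiWeylSuper.series (matrixSeries (psiSeries K) (matC C) μ α)
      - ∑ a, ∑ b, k b μ a • (SemiWeylSuper.ξ a * SemiWeylSuper.q b)
  | .θ a => SemiWeylSuper.ξ a
  | .T1 μ ν => SemiWeylSuper.series (matrixSeries (PowerSeries.exp K) (matC C) μ ν)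
  | .T2 μ a => -∑ b, ∑ c, k b μ c •
      (SemiWeylSuper.series (matrixSeries (PowerSeries.exp K) (matK k) c a) * SemiWeylSuper.q b)
  | .T4 a b => SemiWeylSuper.series (matrixSeries (PowerSeries.exp K) (matK k) a b)

/-- The linear map `φ : g^L → Â_{(n,m)}` with these values on the basis. -/
def weylLinear (C : Fin n → Fin n → Fin n → K) (k : Fin m → Fin n → Fin m → K) :
    ShiftExt n m K →ₗ[K] SemiWeylSuper n m K :=
  Finsupp.linearCombination K (weylLinearBasis C k)

end Realization

end

/-!
Every bracket relation reduces to basis elements, and for these to two differential identities for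
power series in `∂_1, …, ∂_n`. Put `ω = (1 - e^{-ℂ})/ℂ`, the inverse matrix of `ψ(ℂ)`, and let `E`
be the Euler derivation, which multiplies the part of degree `j` by `j`.

* For every right representation `k` of `g_0`, with `𝕂 = ∑ ∂_ρ k_ρ`, one has
  `∑_α ψ(ℂ)_{λα} ∂e^𝕂/∂∂_α = k_λ e^𝕂` (`IsRightRep.sum_psi_mul_pderiv_exp`). Equivalently
  `∂e^𝕂/∂∂_α = ∑_β ω_{αβ} k_β e^𝕂`, the formula for the derivative of the exponential map. Both
  sides satisfy `(E + 1) Y = 𝕂 Y + k_α e^𝕂`: on the left because `E e^𝕂 = 𝕂 e^𝕂`, on the right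
  because `(E + 1) ω = e^{-ℂ}` and `[k_β, 𝕂] = ∑_γ ℂ_{βγ} k_γ`. Comparing coefficients degree by
  degree shows that this equation has only one solution.
* The vector fields `∑_β ψ(ℂ)_{νβ} ∂/∂∂_β` close under brackets with structure constants `-C`
  (`IsRightRep.psi_bracket`). This is dual to the Maurer–Cartan equation for `ω`
  (`IsRightRep.maurerCartan`), whose two sides have the same image under the injective operator
  `E + 2`, once the derivative of `e^{-ℂ}` is known from the first identity for the right adjoint
  representation `k = C`.

The second identity gives `[φ(X_μ), φ(X_ν)]` in the Weyl algebra, and the first one gives the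
brackets of `X_λ` with `T¹` (for `k = C`) and with `T²`, `T⁴` (for the action on `g_1`). What is
left are commutators in the Clifford algebra: the elements `∑ k_{bμa} ξ_a q_b` represent `g_0` up to
sign, and act on the spans of the `ξ_a` and of the `q_a` by `k_μ` and its transpose.

The Jacobi identity of `g^L` only uses that `C` and `k` are right representations, because `X_ν`
acts on `T¹_{μν}` and `T²_{μa}` in the index `μ` as on `X_μ`, and on `T⁴_{ab}` in `a` as on `θ_a`.
-/

noncomputable section

open scoped TensorProduct

/-! ### The Euler derivation on power series -/

/-- The linear map that multiplies the part of degree `j` of a power series by `j`. -/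
def eulerLinear (n : ℕ) (K : Type*) [Field K] : DSeries n K →ₗ[K] DSeries n K where
  toFun f := fun d => (d.degree : K) * MvPowerSeries.coeff d f
  map_add' f g := by
    ext d
    exact (congrArg _ (map_add _ f g)).trans (mul_add _ _ _)
  map_smul' c f := by
    ext d
    exact mul_left_comm _ _ _

theorem coeff_eulerLinear {n : ℕ} {K : Type*} [Field K] (f : DSeries n K) (d : Fin n →₀ ℕ) :
    MvPowerSeries.coeff d (eulerLinear n K f) = d.degree * MvPowerSeries.coeff d f := rfl

/-- The Euler derivation `∑_ρ ∂_ρ · (d/d∂_ρ)`, given by its action on homogeneous parts. -/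
def eulerDerivation (n : ℕ) (K : Type*) [Field K] : Derivation K (DSeries n K) (DSeries n K) :=
  Derivation.mk' (eulerLinear n K) fun f g => by
    classical
    ext d
    rw [coeff_eulerLinear, smul_eq_mul, smul_eq_mul, mul_comm g, map_add, MvPowerSeries.coeff_mul,
      MvPowerSeries.coeff_mul, MvPowerSeries.coeff_mul, Finset.mul_sum, ← Finset.sum_add_distrib]
    refine Finset.sum_congr rfl fun p hp => ?_
    rw [coeff_eulerLinear, coeff_eulerLinear, ← Finset.HasAntidiagonal.mem_antidiagonal.1 hp,
      map_add, Nat.cast_add]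
    ring

section Euler

variable {n : ℕ} {K : Type*} [Field K]

theorem coeff_eulerDerivation (f : DSeries n K) (d : Fin n →₀ ℕ) :
    MvPowerSeries.coeff d (eulerDerivation n K f) = d.degree * MvPowerSeries.coeff d f := rfl

/-- `∂/∂∂_i` lowers the degree by one. -/
theorem eulerDerivation_pderiv (i : Fin n) (f : DSeries n K) :
    eulerDerivation n K (MvPowerSeries.pderiv K i f) + MvPowerSeries.pderiv K i f =
      MvPowerSeries.pderiv K i (eulerDerivation n K f) := by
  ext d
  simp only [map_add, coeff_eulerDerivation, MvPowerSeries.coeff_pderiv, Finsupp.degree_single]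
  push_cast
  ring

/-- `E + c` is injective for `c ≠ 0`: it multiplies the part of degree `j` by `j + c`. -/
theorem eq_zero_of_eulerDerivation_add_nsmul [CharZero K] {f : DSeries n K} {c : ℕ} (hc : c ≠ 0)
    (h : eulerDerivation n K f + c • f = 0) : f = 0 := by
  ext d
  have h1 := congrArg (MvPowerSeries.coeff d) h
  rw [map_add, coeff_eulerDerivation, map_nsmul, map_zero, nsmul_eq_mul, ← add_mul,
    ← Nat.cast_add, mul_eq_zero] at h1
  exact h1.resolve_left (Nat.cast_ne_zero.2 (by omega))

end Euler

theorem Matrix.map_derivation_mul {S R ι κ τ : Type*} [CommSemiring S] [CommRing R] [Algebra S R]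
    [Fintype κ] (D : Derivation S R R) (A : Matrix ι κ R) (B : Matrix κ τ R) :
    (A * B).map D = A.map D * B + A * B.map D := by
  ext a b
  simp only [Matrix.map_apply, Matrix.mul_apply, Matrix.add_apply, map_sum, Derivation.leibniz,
    smul_eq_mul, ← Finset.sum_add_distrib]
  exact Finset.sum_congr rfl fun _ _ => by ring

/-! ### Power series of a matrix of linear forms -/

/-- All entries of the matrix `M` are linear forms in the `∂_ρ`. -/
def IsLinearMatrix {n : ℕ} {K ι : Type*} [Field K] (M : Matrix ι ι (DSeries n K)) : Prop :=
  ∀ a b d, d.degree ≠ 1 → MvPowerSeries.coeff d (M a b) = 0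

namespace IsLinearMatrix

variable {n : ℕ} {K ι : Type*} [Field K] [Fintype ι] {M : Matrix ι ι (DSeries n K)}

/-- For linear `M`, the Euler derivation `E` and `c ≠ 0`, the equation `(E + c) Y = M Y` determines
the coefficients of `Y` degree by degree, so that it has no solution but zero. -/
theorem eq_zero_of_euler [CharZero K] (hM : IsLinearMatrix M) {Y : Matrix ι ι (DSeries n K)}
    {c : ℕ} (hc : c ≠ 0) (h : Y.map (eulerDerivation n K) + c • Y = M * Y) : Y = 0 := by
  classical
  have key : ∀ N : ℕ, ∀ d : Fin n →₀ ℕ, d.degree = N → ∀ a b,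
      MvPowerSeries.coeff d (Y a b) = 0 := by
    intro N
    induction N using Nat.strong_induction_on with
    | _ N ih =>
      intro d hd a b
      have h1 := congrArg (MvPowerSeries.coeff d) (congrFun (congrFun h a) b)
      rw [Matrix.add_apply, Matrix.map_apply, map_add, coeff_eulerDerivation, Matrix.smul_apply,
        map_nsmul, nsmul_eq_mul, ← add_mul, ← Nat.cast_add, Matrix.mul_apply, map_sum,
        Finset.sum_eq_zero] at h1
      · exact (mul_eq_zero.1 h1).resolve_left (Nat.cast_ne_zero.2 (by omega))
      · intro t _
        rw [MvPowerSeries.coeff_mul]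
        refine Finset.sum_eq_zero fun p hp => ?_
        have hp := congrArg Finsupp.degree (Finset.HasAntidiagonal.mem_antidiagonal.1 hp)
        rw [map_add] at hp
        by_cases h1 : p.1.degree = 1
        · rw [ih p.2.degree (by omega) p.2 rfl, mul_zero]
        · rw [hM _ _ _ h1, zero_mul]
  ext a b d
  exact key _ d rfl a b

variable [DecidableEq ι]

theorem coeff_pow_eq_zero (hM : IsLinearMatrix M) (j : ℕ) (a b : ι) (d : Fin n →₀ ℕ)
    (hd : d.degree ≠ j) : MvPowerSeries.coeff d ((M ^ j) a b) = 0 := by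
  classical
  induction j generalizing a b d with
  | zero =>
    rw [pow_zero, Matrix.one_apply]
    have : d ≠ 0 := by rintro rfl; exact hd (map_zero _)
    split_ifs <;> simp [MvPowerSeries.coeff_one, this]
  | succ j ih =>
    rw [pow_succ, Matrix.mul_apply, map_sum]
    refine Finset.sum_eq_zero fun t _ => ?_
    rw [MvPowerSeries.coeff_mul]
    refine Finset.sum_eq_zero fun p hp => ?_
    have hp := congrArg Finsupp.degree (Finset.HasAntidiagonal.mem_antidiagonal.1 hp)
    rw [map_add] at hp
    by_cases h1 : p.1.degree = j
    · rw [hM _ _ _ (by omega), mul_zero]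
    · rw [ih _ _ _ h1, zero_mul]

/-- For a matrix of linear forms only one power of `M` contributes to a given coefficient. -/
theorem coeff_matrixSeries (hM : IsLinearMatrix M) (f : PowerSeries K) (a b : ι)
    (d : Fin n →₀ ℕ) :
    MvPowerSeries.coeff d (matrixSeries f M a b) =
      PowerSeries.coeff d.degree f * MvPowerSeries.coeff d ((M ^ d.degree) a b) := by
  change ∑ j ∈ Finset.range (d.degree + 1), PowerSeries.coeff j f *
    MvPowerSeries.coeff d ((M ^ j) a b) = _
  refine Finset.sum_eq_single d.degree (fun j _ hj => ?_) fun h => ?_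
  · rw [hM.coeff_pow_eq_zero j a b d (Ne.symm hj), mul_zero]
  · exact absurd (Finset.self_mem_range_succ _) h

theorem matrixSeries_mul (hM : IsLinearMatrix M) (f g : PowerSeries K) :
    matrixSeries (f * g) M = matrixSeries f M * matrixSeries g M := by
  classical
  ext a b d
  rw [hM.coeff_matrixSeries, PowerSeries.coeff_mul, Finset.sum_mul, Matrix.mul_apply, map_sum]
  have hl : ∀ p ∈ Finset.HasAntidiagonal.antidiagonal d.degree,
      PowerSeries.coeff p.1 f * PowerSeries.coeff p.2 g *
        MvPowerSeries.coeff d ((M ^ d.degree) a b) =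
          ∑ t, ∑ r ∈ Finset.HasAntidiagonal.antidiagonal d,
      PowerSeries.coeff p.1 f * PowerSeries.coeff p.2 g *
        (MvPowerSeries.coeff r.1 ((M ^ p.1) a t) * MvPowerSeries.coeff r.2 ((M ^ p.2) t b)) := by
    intro p hp
    rw [← Finset.HasAntidiagonal.mem_antidiagonal.1 hp, pow_add, Matrix.mul_apply, map_sum,
      Finset.mul_sum]
    refine Finset.sum_congr rfl fun t _ => ?_
    rw [MvPowerSeries.coeff_mul, Finset.mul_sum]
  rw [Finset.sum_congr rfl hl, Finset.sum_comm]
  refine Finset.sum_congr rfl fun t _ => ?_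
  rw [Finset.sum_comm, MvPowerSeries.coeff_mul]
  refine Finset.sum_congr rfl fun r hr => ?_
  have hr := congrArg Finsupp.degree (Finset.HasAntidiagonal.mem_antidiagonal.1 hr)
  rw [map_add] at hr
  rw [Finset.sum_eq_single (r.1.degree, r.2.degree), hM.coeff_matrixSeries, hM.coeff_matrixSeries]
  · ring
  · intro p _ hp
    by_cases h1 : r.1.degree = p.1
    · rw [hM.coeff_pow_eq_zero p.2 t b r.2 fun h2 => hp (Prod.ext h1.symm h2.symm), mul_zero,
        mul_zero]
    · rw [hM.coeff_pow_eq_zero p.1 a t r.1 h1, zero_mul, mul_zero]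
  · intro h
    exact absurd (Finset.HasAntidiagonal.mem_antidiagonal.2 hr) h

theorem matrixSeries_one (hM : IsLinearMatrix M) : matrixSeries 1 M = 1 := by
  ext a b d
  rw [hM.coeff_matrixSeries, PowerSeries.coeff_one]
  split_ifs with h
  · rw [h, pow_zero, one_mul]
  · rw [zero_mul]
    exact (hM.coeff_pow_eq_zero 0 a b d h).symm

theorem matrixSeries_X (hM : IsLinearMatrix M) : matrixSeries PowerSeries.X M = M := by
  ext a b d
  rw [hM.coeff_matrixSeries, PowerSeries.coeff_X]
  split_ifs with h
  · rw [h, pow_one, one_mul]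
  · rw [zero_mul, hM a b d h]

theorem matrixSeries_add (hM : IsLinearMatrix M) (f g : PowerSeries K) :
    matrixSeries (f + g) M = matrixSeries f M + matrixSeries g M := by
  ext a b d
  rw [Matrix.add_apply, map_add, hM.coeff_matrixSeries, hM.coeff_matrixSeries,
    hM.coeff_matrixSeries, map_add, add_mul]

/-- The Euler derivation acts on `f(M)` as `t d/dt` acts on `f`. -/
theorem map_eulerDerivation_matrixSeries (hM : IsLinearMatrix M) (f : PowerSeries K) :
    (matrixSeries f M).map (eulerDerivation n K) =
      matrixSeries (PowerSeries.X * PowerSeries.derivative K f) M := by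
  ext a b d
  rw [Matrix.map_apply, coeff_eulerDerivation, hM.coeff_matrixSeries, hM.coeff_matrixSeries,
    ← mul_assoc]
  congr 1
  rcases d.degree with _ | j
  · simp
  · rw [PowerSeries.coeff_succ_X_mul, PowerSeries.coeff_derivative]
    push_cast
    ring

end IsLinearMatrix

/-! ### The derivatives of `e^𝕂` and of `ψ(ℂ)` -/

/-- The series `e^{-t}`. -/
def expNegSeries (K : Type*) [Field K] [CharZero K] : PowerSeries K :=
  PowerSeries.evalNegHom (PowerSeries.exp K)

/-- The series `(1 - e^{-t}) / t`, the inverse of `ψ(t)`. -/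
def phiSeries (K : Type*) [Field K] [CharZero K] : PowerSeries K :=
  PowerSeries.mk fun j => PowerSeries.coeff (j + 1) (1 - expNegSeries K)

section Series

variable (K : Type*) [Field K] [CharZero K]

theorem X_mul_phiSeries : PowerSeries.X * phiSeries K = 1 - expNegSeries K := by
  have h := PowerSeries.sub_const_eq_X_mul_shift (1 - expNegSeries K)
  rw [phiSeries, ← h, sub_eq_self]
  have h0 : PowerSeries.constantCoeff (expNegSeries K) = 1 := by
    rw [← PowerSeries.coeff_zero_eq_constantCoeff_apply, expNegSeries, PowerSeries.evalNegHom,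
      PowerSeries.coeff_rescale]
    simp
  rw [map_sub, map_one, h0, sub_self, map_zero]

theorem psiSeries_mul_phiSeries : psiSeries K * phiSeries K = 1 := by
  refine mul_left_cancel₀ PowerSeries.X_ne_zero ?_
  rw [mul_left_comm, X_mul_phiSeries, mul_one]
  exact psiSeries_mul K

theorem derivative_expNegSeries :
    PowerSeries.derivative K (expNegSeries K) = -expNegSeries K := by
  have h : PowerSeries.exp K * expNegSeries K = 1 := PowerSeries.exp_mul_exp_neg_eq_one
  have h1 := congrArg (PowerSeries.derivative K) h
  rw [Derivation.leibniz, PowerSeries.derivative_exp, PowerSeries.derivative_one, smul_eq_mul,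
    smul_eq_mul] at h1
  have h2 := congrArg (expNegSeries K * ·) h1
  simp only [mul_add, ← mul_assoc, mul_comm (expNegSeries K) (PowerSeries.exp K), h, one_mul,
    mul_zero] at h2
  rw [mul_one] at h2
  exact eq_neg_of_add_eq_zero_left h2

/-- `d/dt` of `t · (1 - e^{-t})/t` is `e^{-t}`. -/
theorem X_mul_derivative_phiSeries :
    PowerSeries.X * PowerSeries.derivative K (phiSeries K) + phiSeries K = expNegSeries K := by
  have h := congrArg (PowerSeries.derivative K) (X_mul_phiSeries K)
  rw [Derivation.leibniz, map_sub, PowerSeries.derivative_one, derivative_expNegSeries,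
    PowerSeries.derivative_X, smul_eq_mul, smul_eq_mul, mul_one, zero_sub, neg_neg] at h
  exact h

end Series

section DerivationMatrix

variable {S R ι κ : Type*} [CommSemiring S] [CommRing R] [Algebra S R] (D : Derivation S R R)

theorem Matrix.map_derivation_smul (f : R) (A : Matrix ι κ R) :
    (f • A).map D = D f • A + f • A.map D := by
  ext a b
  simp [mul_comm, add_comm]

theorem Matrix.map_derivation_sub (A B : Matrix ι κ R) :
    (A - B).map D = A.map D - B.map D := by
  ext a b
  simp

theorem Matrix.map_derivation_sum {τ : Type*} (s : Finset τ) (A : τ → Matrix ι κ R) :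
    (∑ i ∈ s, A i).map D = ∑ i ∈ s, (A i).map D := by
  ext a b
  simp [Matrix.sum_apply]

theorem Matrix.map_derivation_one [DecidableEq ι] : (1 : Matrix ι ι R).map D = 0 := by
  ext a b
  rw [Matrix.map_apply, Matrix.one_apply]
  split_ifs <;> simp

end DerivationMatrix

/-- The matrices `k_ν = (k_{aνb})_{ab}` satisfy `k_μ k_ν - k_ν k_μ = ∑_γ C_{μνγ} k_γ`: they are the
right action on `g_1` (on `g_0` for `k = C`) of a Lie algebra with structure constants `C`. -/
def IsRightRep {n m : ℕ} {K : Type*} [Field K] (C : Fin n → Fin n → Fin n → K)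
    (k : Fin m → Fin n → Fin m → K) : Prop :=
  ∀ a μ ν b, ∑ c, k a μ c * k c ν b - ∑ c, k a ν c * k c μ b = ∑ γ, C μ ν γ * k a γ b

/-- The constant matrix `k_α = (k_{aαb})_{ab}`. -/
def actionMatrix {n m : ℕ} {K : Type*} [Field K] (k : Fin m → Fin n → Fin m → K) (α : Fin n) :
    Matrix (Fin m) (Fin m) (DSeries n K) :=
  Matrix.of fun a b => MvPowerSeries.C (k a α b)

section Exponential

variable {n m : ℕ} {K : Type*} [Field K] {C : Fin n → Fin n → Fin n → K}
  {k : Fin m → Fin n → Fin m → K}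

theorem matK_eq_sum (k : Fin m → Fin n → Fin m → K) :
    matK k = ∑ ρ, (MvPowerSeries.X ρ : DSeries n K) • actionMatrix k ρ := by
  refine Matrix.ext fun a b => ?_
  simp only [matK, actionMatrix, Matrix.sum_apply, Matrix.of_apply, Matrix.smul_apply, smul_eq_mul,
    MvPowerSeries.smul_eq_C_mul, mul_comm]

theorem isLinearMatrix_matK (k : Fin m → Fin n → Fin m → K) : IsLinearMatrix (matK k) := by
  classical
  intro a b d hd
  rw [matK, Matrix.of_apply, map_sum]
  refine Finset.sum_eq_zero fun ρ _ => ?_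
  rw [MvPowerSeries.coeff_smul, MvPowerSeries.coeff_X, if_neg, mul_zero]
  rintro rfl
  exact hd (Finsupp.degree_single _ _)

theorem isLinearMatrix_matC (C : Fin n → Fin n → Fin n → K) : IsLinearMatrix (matC C) :=
  isLinearMatrix_matK C

theorem map_pderiv_matK (k : Fin m → Fin n → Fin m → K) (α : Fin n) :
    (matK k).map (MvPowerSeries.pderiv K α) = actionMatrix k α := by
  classical
  refine Matrix.ext fun a b => ?_
  rw [Matrix.map_apply, matK, Matrix.of_apply, map_sum, actionMatrix, Matrix.of_apply,
    Finset.sum_eq_single α]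
  · rw [Derivation.map_smul, MvPowerSeries.pderiv_X_self, MvPowerSeries.smul_eq_C_mul, mul_one]
  · intro ρ _ h
    rw [Derivation.map_smul, MvPowerSeries.pderiv_X_of_ne h, smul_zero]
  · simp

theorem map_derivation_actionMatrix (D : Derivation K (DSeries n K) (DSeries n K)) (α : Fin n) :
    (actionMatrix k α).map D = 0 := by
  refine Matrix.ext fun a b => ?_
  exact D.map_algebraMap (k a α b)

theorem IsRightRep.actionMatrix_mul_actionMatrix (h : IsRightRep C k) (β ρ : Fin n) :
    actionMatrix k β * actionMatrix k ρ =
      actionMatrix k ρ * actionMatrix k β + ∑ γ, C β ρ γ • actionMatrix k γ := by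
  refine Matrix.ext fun a b => ?_
  have := congrArg (MvPowerSeries.C (σ := Fin n)) (h a β ρ b)
  simp only [map_sub, map_sum, map_mul] at this
  simp only [actionMatrix, Matrix.mul_apply, Matrix.add_apply, Matrix.of_apply, Matrix.sum_apply,
    Matrix.smul_apply, MvPowerSeries.smul_eq_C_mul]
  rw [← this, add_sub_cancel]

/-- `[k_β, 𝕂] = ∑_γ ℂ_{βγ} k_γ`. -/
theorem IsRightRep.actionMatrix_mul_matK (h : IsRightRep C k) (β : Fin n) :
    actionMatrix k β * matK k =
      matK k * actionMatrix k β + ∑ γ, matC C β γ • actionMatrix k γ := by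
  rw [matK_eq_sum, Finset.mul_sum, Finset.sum_mul]
  simp only [matC, Matrix.of_apply, Finset.sum_smul]
  rw [Finset.sum_comm, ← Finset.sum_add_distrib]
  refine Finset.sum_congr rfl fun ρ _ => ?_
  rw [mul_smul_comm, h.actionMatrix_mul_actionMatrix, smul_add, smul_mul_assoc, Finset.smul_sum]
  simp only [smul_comm _ (MvPowerSeries.X ρ : DSeries n K), smul_assoc]

variable [CharZero K]

/-- `E e^𝕂 = 𝕂 e^𝕂`. -/
theorem map_euler_exp (k : Fin m → Fin n → Fin m → K) :
    (matrixSeries (PowerSeries.exp K) (matK k)).map (eulerDerivation n K) =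
      matK k * matrixSeries (PowerSeries.exp K) (matK k) := by
  have hM := isLinearMatrix_matK k
  rw [hM.map_eulerDerivation_matrixSeries, PowerSeries.derivative_exp, hM.matrixSeries_mul,
    hM.matrixSeries_X]

/-- `(E + 1) ω = e^{-ℂ}`. -/
theorem euler_phi (C : Fin n → Fin n → Fin n → K) (α β : Fin n) :
    eulerDerivation n K (matrixSeries (phiSeries K) (matC C) α β) +
      matrixSeries (phiSeries K) (matC C) α β = matrixSeries (expNegSeries K) (matC C) α β := by
  have hM := isLinearMatrix_matC C
  rw [← X_mul_derivative_phiSeries, hM.matrixSeries_add, ← hM.map_eulerDerivation_matrixSeries]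
  rfl

theorem phi_mul_matC (C : Fin n → Fin n → Fin n → K) :
    matrixSeries (phiSeries K) (matC C) * matC C =
      1 - matrixSeries (expNegSeries K) (matC C) := by
  have hM := isLinearMatrix_matC C
  have h := hM.matrixSeries_mul (phiSeries K) PowerSeries.X
  rw [mul_comm, X_mul_phiSeries, hM.matrixSeries_X] at h
  rw [← h, eq_sub_iff_add_eq, ← hM.matrixSeries_add, sub_add_cancel, hM.matrixSeries_one]

theorem psi_mul_phi (C : Fin n → Fin n → Fin n → K) :
    matrixSeries (psiSeries K) (matC C) * matrixSeries (phiSeries K) (matC C) = 1 := by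
  have hM := isLinearMatrix_matC C
  rw [← hM.matrixSeries_mul, psiSeries_mul_phiSeries, hM.matrixSeries_one]

theorem exp_mul_expNeg (C : Fin n → Fin n → Fin n → K) :
    matrixSeries (PowerSeries.exp K) (matC C) * matrixSeries (expNegSeries K) (matC C) = 1 := by
  have hM := isLinearMatrix_matC C
  rw [← hM.matrixSeries_mul, expNegSeries, PowerSeries.exp_mul_exp_neg_eq_one, hM.matrixSeries_one]

/-- The derivative of the exponential map in the representation `k`. Both sides solve
`(E + 1) Y_α = 𝕂 Y_α + k_α e^𝕂`, with `E` the Euler derivation, and the solution is unique. -/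
theorem IsRightRep.map_pderiv_exp (h : IsRightRep C k) (α : Fin n) :
    (matrixSeries (PowerSeries.exp K) (matK k)).map (MvPowerSeries.pderiv K α) =
      ∑ β, matrixSeries (phiSeries K) (matC C) α β •
        (actionMatrix k β * matrixSeries (PowerSeries.exp K) (matK k)) := by
  have hE := map_euler_exp k
  have hω := euler_phi C α
  have hωC := phi_mul_matC C
  set e := matrixSeries (PowerSeries.exp K) (matK k)
  set ω := matrixSeries (phiSeries K) (matC C)
  set ε := matrixSeries (expNegSeries K) (matC C)
  have h1 : (e.map (MvPowerSeries.pderiv K α)).map (eulerDerivation n K) +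
      e.map (MvPowerSeries.pderiv K α) =
      matK k * e.map (MvPowerSeries.pderiv K α) + actionMatrix k α * e := by
    have h2 : (e.map (MvPowerSeries.pderiv K α)).map (eulerDerivation n K) +
        e.map (MvPowerSeries.pderiv K α) =
        (e.map (eulerDerivation n K)).map (MvPowerSeries.pderiv K α) := by
      refine Matrix.ext fun a b => ?_
      exact eulerDerivation_pderiv α (e a b)
    rw [h2, hE, Matrix.map_derivation_mul, map_pderiv_matK, add_comm]
  -- The right side solves the same equation; `h5` uses `ω ℂ = 1 - e^{-ℂ}`.
  have h3 : (∑ β, ω α β • (actionMatrix k β * e)).map (eulerDerivation n K) +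
      ∑ β, ω α β • (actionMatrix k β * e) =
      matK k * ∑ β, ω α β • (actionMatrix k β * e) + actionMatrix k α * e := by
    have h4 : ∀ β, (ω α β • (actionMatrix k β * e)).map (eulerDerivation n K) +
        ω α β • (actionMatrix k β * e) = ε α β • (actionMatrix k β * e) +
          (matK k * (ω α β • (actionMatrix k β * e)) +
            ∑ γ, (ω α β * matC C β γ) • (actionMatrix k γ * e)) := by
      intro β
      rw [Matrix.map_derivation_smul, Matrix.map_derivation_mul, map_derivation_actionMatrix,
        zero_mul, zero_add, hE, ← mul_assoc, h.actionMatrix_mul_matK, add_mul, Finset.sum_mul,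
        smul_add, Finset.smul_sum, ← hω β, add_smul, mul_smul_comm, mul_assoc]
      simp only [smul_mul_assoc, mul_smul]
      abel
    have h5 : ∑ β, ∑ γ, (ω α β * matC C β γ) • (actionMatrix k γ * e) =
        actionMatrix k α * e - ∑ β, ε α β • (actionMatrix k β * e) := by
      rw [Finset.sum_comm]
      simp only [← Finset.sum_smul, ← Matrix.mul_apply, hωC, Matrix.sub_apply, sub_smul,
        Finset.sum_sub_distrib, Matrix.one_apply, ite_smul, one_smul, zero_smul, Finset.sum_ite_eq,
        Finset.mem_univ, if_true]
    rw [Matrix.map_derivation_sum, ← Finset.sum_add_distrib, Finset.sum_congr rfl fun β _ => h4 β,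
      Finset.sum_add_distrib, Finset.sum_add_distrib, h5, Finset.mul_sum]
    abel
  refine sub_eq_zero.1 ((isLinearMatrix_matK k).eq_zero_of_euler one_ne_zero ?_)
  rw [one_smul, Matrix.map_derivation_sub, sub_add_sub_comm, h1, h3, mul_sub]
  abel

/-- The vector fields `∑_α ψ(ℂ)_{λα} ∂/∂∂_α` act on `e^𝕂` by left multiplication with `k_λ`. -/
theorem IsRightRep.sum_psi_smul_map_pderiv_exp (h : IsRightRep C k) (lam : Fin n) :
    ∑ α, matrixSeries (psiSeries K) (matC C) lam α •
        (matrixSeries (PowerSeries.exp K) (matK k)).map (MvPowerSeries.pderiv K α) =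
      actionMatrix k lam * matrixSeries (PowerSeries.exp K) (matK k) := by
  have hψ := psi_mul_phi C
  simp only [h.map_pderiv_exp, Finset.smul_sum, smul_smul]
  rw [Finset.sum_comm]
  simp only [← Finset.sum_smul, ← Matrix.mul_apply, hψ, Matrix.one_apply, ite_smul, one_smul,
    zero_smul, Finset.sum_ite_eq, Finset.mem_univ, if_true]

/-- The entries of `sum_psi_smul_map_pderiv_exp`. -/
theorem IsRightRep.sum_psi_mul_pderiv_exp (h : IsRightRep C k) (lam : Fin n) (a b : Fin m) :
    ∑ α, matrixSeries (psiSeries K) (matC C) lam α *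
        MvPowerSeries.pderiv K α (matrixSeries (PowerSeries.exp K) (matK k) a b) =
      ∑ c, k a lam c • matrixSeries (PowerSeries.exp K) (matK k) c b := by
  have h1 := congrFun (congrFun (h.sum_psi_smul_map_pderiv_exp lam) a) b
  simpa only [Matrix.sum_apply, Matrix.smul_apply, Matrix.map_apply, Matrix.mul_apply,
    actionMatrix, Matrix.of_apply, smul_eq_mul, ← MvPowerSeries.smul_eq_C_mul] using h1

/-- `∂e^{-ℂ}/∂∂_α = -∑_δ ω_{αδ} e^{-ℂ} C_δ`, where `(C_δ)_{σγ} = C_{σδγ}`: differentiate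
`e^ℂ e^{-ℂ} = 1` and use the derivative of `e^ℂ` in the right adjoint representation. -/
theorem IsRightRep.pderiv_expNeg (h : IsRightRep C C) (α β γ : Fin n) :
    MvPowerSeries.pderiv K α (matrixSeries (expNegSeries K) (matC C) β γ) =
      -∑ δ, ∑ σ, C σ δ γ • (matrixSeries (phiSeries K) (matC C) α δ *
        matrixSeries (expNegSeries K) (matC C) β σ) := by
  have h1 := h.map_pderiv_exp α
  have he := exp_mul_expNeg C
  have he' := mul_eq_one_comm.1 he
  have h2 : matrixSeries (PowerSeries.exp K) (matK C) =
    matrixSeries (PowerSeries.exp K) (matC C) := rfl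
  rw [h2] at h1
  set e := matrixSeries (PowerSeries.exp K) (matC C)
  set ω := matrixSeries (phiSeries K) (matC C)
  set ε := matrixSeries (expNegSeries K) (matC C)
  have h3 : ε.map (MvPowerSeries.pderiv K α) =
      -∑ δ, ω α δ • (ε * actionMatrix C δ) := by
    have h4 := congrArg (fun A => A.map (MvPowerSeries.pderiv K α)) he
    simp only [Matrix.map_derivation_one, Matrix.map_derivation_mul] at h4
    have h5 := congrArg (ε * ·) h4
    simp only [mul_add, ← mul_assoc, he', one_mul, mul_zero] at h5
    rw [eq_neg_of_add_eq_zero_right h5, h1, Finset.mul_sum, Finset.sum_mul]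
    congr 1
    refine Finset.sum_congr rfl fun δ _ => ?_
    rw [mul_smul_comm, smul_mul_assoc, mul_assoc, mul_assoc, he, mul_one]
  have h6 := congrFun (congrFun h3 β) γ
  rw [Matrix.map_apply] at h6
  rw [h6, Matrix.neg_apply, Matrix.sum_apply]
  congr 1
  refine Finset.sum_congr rfl fun δ _ => ?_
  rw [Matrix.smul_apply, Matrix.mul_apply, smul_eq_mul, Finset.mul_sum]
  refine Finset.sum_congr rfl fun σ _ => ?_
  rw [actionMatrix, Matrix.of_apply, MvPowerSeries.smul_eq_C_mul]
  ring

/-- The Maurer–Cartan equation for the invariant forms `∑_α ω_{αγ} d∂_α`, `ω = (1-e^{-ℂ})/ℂ`.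
Both sides have the same image under `E + 2`, with `E` the Euler derivation. -/
theorem IsRightRep.maurerCartan (h : IsRightRep C C) (hC : ∀ μ ν γ, C μ ν γ = -C ν μ γ)
    (α β γ : Fin n) :
    MvPowerSeries.pderiv K α (matrixSeries (phiSeries K) (matC C) β γ) -
        MvPowerSeries.pderiv K β (matrixSeries (phiSeries K) (matC C) α γ) =
      ∑ δ, ∑ σ, C δ σ γ • (matrixSeries (phiSeries K) (matC C) α δ *
        matrixSeries (phiSeries K) (matC C) β σ) := by
  have hω := euler_phi C
  have hε := h.pderiv_expNeg
  set ω := matrixSeries (phiSeries K) (matC C)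
  set ε := matrixSeries (expNegSeries K) (matC C)
  have h1 : ∀ α β, eulerDerivation n K (MvPowerSeries.pderiv K α (ω β γ)) +
      2 • MvPowerSeries.pderiv K α (ω β γ) = MvPowerSeries.pderiv K α (ε β γ) := by
    intro α β
    rw [← hω, map_add, ← eulerDerivation_pderiv, two_nsmul, add_assoc]
  have h2 : ∀ δ σ, eulerDerivation n K (C δ σ γ • (ω α δ * ω β σ)) +
      2 • (C δ σ γ • (ω α δ * ω β σ)) =
        C δ σ γ • (ω α δ * ε β σ) + C δ σ γ • (ε α δ * ω β σ) := by
    intro δ σ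
    rw [Derivation.map_smul, Derivation.leibniz, ← hω, ← hω, smul_comm 2, ← smul_add, ← smul_add,
      smul_eq_mul, smul_eq_mul]
    congr 1
    ring
  refine sub_eq_zero.1 (eq_zero_of_eulerDerivation_add_nsmul two_ne_zero ?_)
  have h3 : ∀ a b c : DSeries n K, eulerDerivation n K (a - b - c) + 2 • (a - b - c) =
      (eulerDerivation n K a + 2 • a) - (eulerDerivation n K b + 2 • b) -
        (eulerDerivation n K c + 2 • c) := by
    intro a b c
    simp only [map_sub, smul_sub]
    abel
  rw [h3, h1, h1, hε, hε, map_sum, Finset.smul_sum, ← Finset.sum_add_distrib]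
  simp only [map_sum, Finset.smul_sum, ← Finset.sum_add_distrib, h2]
  rw [Finset.sum_comm (f := fun δ σ => C σ δ γ • (ω β δ * ε α σ)), ← Finset.sum_neg_distrib,
    sub_neg_eq_add, ← Finset.sum_add_distrib, ← Finset.sum_sub_distrib]
  refine Finset.sum_eq_zero fun δ _ => ?_
  rw [← Finset.sum_neg_distrib, ← Finset.sum_add_distrib, ← Finset.sum_sub_distrib]
  refine Finset.sum_eq_zero fun σ _ => ?_
  rw [hC σ δ γ, neg_smul, neg_neg, mul_comm (ω β σ), sub_self]

/-- The vector fields `∑_β ψ(ℂ)_{νβ} ∂/∂∂_β` span a Lie algebra with structure constants `-C`. -/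
theorem IsRightRep.psi_bracket (h : IsRightRep C C) (hC : ∀ μ ν γ, C μ ν γ = -C ν μ γ)
    (μ ν α : Fin n) :
    ∑ β, matrixSeries (psiSeries K) (matC C) ν β *
          MvPowerSeries.pderiv K β (matrixSeries (psiSeries K) (matC C) μ α) -
        ∑ β, matrixSeries (psiSeries K) (matC C) μ β *
          MvPowerSeries.pderiv K β (matrixSeries (psiSeries K) (matC C) ν α) =
      ∑ γ, C μ ν γ • matrixSeries (psiSeries K) (matC C) γ α := by
  have hMC := h.maurerCartan hC
  have hψω := psi_mul_phi C
  have hωψ := mul_eq_one_comm.1 hψω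
  set ω := matrixSeries (phiSeries K) (matC C)
  set ψ := matrixSeries (psiSeries K) (matC C)
  have h1 : ∀ β, ψ.map (MvPowerSeries.pderiv K β) =
      -(ψ * ω.map (MvPowerSeries.pderiv K β) * ψ) := by
    intro β
    have h4 := congrArg (fun A => A.map (MvPowerSeries.pderiv K β)) hψω
    simp only [Matrix.map_derivation_one, Matrix.map_derivation_mul] at h4
    have h5 := congrArg (· * ψ) h4
    simp only [add_mul, mul_assoc, hωψ, mul_one, zero_mul] at h5
    rw [eq_neg_of_add_eq_zero_left h5, mul_assoc]
  have h2 : ∀ μ ν, ∑ β, ψ ν β * MvPowerSeries.pderiv K β (ψ μ α) =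
      -∑ γ, (∑ β, ∑ δ, ψ ν β * ψ μ δ * MvPowerSeries.pderiv K β (ω δ γ)) * ψ γ α := by
    intro μ ν
    have h3 : ∀ β, MvPowerSeries.pderiv K β (ψ μ α) =
        -∑ γ, (∑ δ, ψ μ δ * MvPowerSeries.pderiv K β (ω δ γ)) * ψ γ α := fun β =>
      congrFun (congrFun (h1 β) μ) α
    simp only [h3, mul_neg, Finset.sum_neg_distrib, Finset.mul_sum, Finset.sum_mul]
    rw [Finset.sum_comm]
    simp only [mul_assoc]
  -- Contracting the Maurer–Cartan equation with `ψ = ω⁻¹` twice leaves the structure constants.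
  have h4 : ∀ γ, ∑ β, ∑ δ, ψ μ β * ψ ν δ * MvPowerSeries.pderiv K β (ω δ γ) -
      ∑ β, ∑ δ, ψ ν β * ψ μ δ * MvPowerSeries.pderiv K β (ω δ γ) =
        MvPowerSeries.C (C μ ν γ) := by
    intro γ
    rw [Finset.sum_comm (f := fun β δ => ψ ν β * ψ μ δ * MvPowerSeries.pderiv K β (ω δ γ)),
      ← Finset.sum_sub_distrib]
    have h5 : ∀ β, ∑ δ, ψ μ β * ψ ν δ * MvPowerSeries.pderiv K β (ω δ γ) -
        ∑ δ, ψ ν δ * ψ μ β * MvPowerSeries.pderiv K δ (ω β γ) =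
        ∑ δ, ψ μ β * ψ ν δ * ∑ σ, ∑ τ, C σ τ γ • (ω β σ * ω δ τ) := by
      intro β
      rw [← Finset.sum_sub_distrib]
      refine Finset.sum_congr rfl fun δ _ => ?_
      rw [mul_comm (ψ ν δ), ← mul_sub, hMC]
    have h6 : ∀ σ τ, C σ τ γ • ((ψ * ω) μ σ * (ψ * ω) ν τ) =
        ∑ β, ∑ δ, ψ μ β * ψ ν δ * C σ τ γ • (ω β σ * ω δ τ) := by
      intro σ τ
      rw [Matrix.mul_apply, Matrix.mul_apply, Finset.sum_mul_sum, Finset.smul_sum]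
      refine Finset.sum_congr rfl fun β _ => ?_
      rw [Finset.smul_sum]
      refine Finset.sum_congr rfl fun δ _ => ?_
      rw [mul_smul_comm, mul_mul_mul_comm]
    calc _ = ∑ σ, ∑ τ, C σ τ γ • ((ψ * ω) μ σ * (ψ * ω) ν τ) := by
          simp only [h5, h6, Finset.mul_sum]
          simpa only [Fintype.sum_prod_type] using Finset.sum_comm (s := Finset.univ)
            (t := Finset.univ) (f := fun (p : Fin n × Fin n) (r : Fin n × Fin n) =>
              ψ μ p.1 * ψ ν p.2 * C r.1 r.2 γ • (ω p.1 r.1 * ω p.2 r.2))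
      _ = _ := by
          rw [hψω]
          simp [Matrix.one_apply, MvPowerSeries.smul_eq_C_mul, Finset.sum_ite_eq]
  rw [h2, h2, neg_sub_neg, ← Finset.sum_sub_distrib]
  refine Finset.sum_congr rfl fun γ _ => ?_
  rw [← sub_mul, h4, MvPowerSeries.smul_eq_C_mul]

end Exponential

/-! ### The Lie superalgebra `g^L` -/

namespace IsLieSuperalgebra

variable {K V : Type*} [Field K] [AddCommGroup V] [Module K V] {g : ZMod 2 → Submodule K V}
  {br : V →ₗ[K] V →ₗ[K] V}

theorem skew_even (hg : IsLieSuperalgebra g br) {i : ZMod 2} {x y : V} (hx : x ∈ g i)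
    (hy : y ∈ g 0) : br y x = -br x y := by
  have h := hg.skew 0 i y hy x hx
  rwa [ZMod.val_zero, zero_mul, pow_zero, one_smul] at h

/-- The even elements act on each homogeneous part from the right. -/
theorem bracket_bracket_even (hg : IsLieSuperalgebra g br) {i : ZMod 2} {a x y : V} (ha : a ∈ g i)
    (hx : x ∈ g 0) (hy : y ∈ g 0) : br (br a x) y - br (br a y) x = br a (br x y) := by
  have h := hg.jacobi i 0 0 a ha x hx y hy
  have h1 : ∀ z ∈ g 0, br a z ∈ g i := fun z hz => by
    simpa using hg.bracket_mem i 0 a ha z hz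
  simp only [ZMod.val_zero, zero_mul, mul_zero, pow_zero, one_smul] at h
  rw [hg.skew_even ha hy, map_neg, hg.skew_even (h1 y hy) hx, hg.skew_even (h1 x hx) hy] at h
  rw [eq_comm, ← sub_eq_zero, ← h]
  abel

/-- The structure constants of the right action of `g 0` on `g i` form a right representation. -/
theorem isRightRep (hg : IsLieSuperalgebra g br) {n m : ℕ} {i : ZMod 2}
    (X : Module.Basis (Fin n) K (g 0)) (b : Module.Basis (Fin m) K (g i))
    {C : Fin n → Fin n → Fin n → K} {k : Fin m → Fin n → Fin m → K}
    (hXX : ∀ μ ν, br (X μ) (X ν) = ∑ α, C μ ν α • (X α : V))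
    (hbX : ∀ a ν, br (b a) (X ν) = ∑ c, k a ν c • (b c : V)) : IsRightRep C k := by
  intro a μ ν d
  have h := hg.bracket_bracket_even (b a).2 (X μ).2 (X ν).2
  simp only [hXX, hbX, map_sum, map_smul, LinearMap.sum_apply, LinearMap.smul_apply,
    Finset.smul_sum, smul_smul] at h
  rw [Finset.sum_comm, Finset.sum_comm (f := fun c e => (k a ν c * k c μ e) • (b e : V)),
    Finset.sum_comm (f := fun γ e => (C μ ν γ * k a γ e) • (b e : V))] at h
  simp only [← Finset.sum_smul, ← Finset.sum_sub_distrib, ← sub_smul] at h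
  rw [← sub_eq_zero, ← Finset.sum_sub_distrib] at h
  simp only [← sub_smul] at h
  have h2 := Fintype.linearIndependent_iff.1 b.linearIndependent _
    (Subtype.ext (by simpa using h)) d
  rwa [sub_eq_zero] at h2

theorem structureConstants_antisymm (hg : IsLieSuperalgebra g br) {n : ℕ}
    (X : Module.Basis (Fin n) K (g 0)) {C : Fin n → Fin n → Fin n → K}
    (hXX : ∀ μ ν, br (X μ) (X ν) = ∑ α, C μ ν α • (X α : V)) (μ ν γ : Fin n) :
    C μ ν γ = -C ν μ γ := by
  have h := hg.skew_even (X ν).2 (X μ).2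
  rw [hXX, hXX, ← sub_eq_zero, sub_neg_eq_add, ← Finset.sum_add_distrib] at h
  simp only [← add_smul] at h
  have h2 := Fintype.linearIndependent_iff.1 X.linearIndependent _
    (Subtype.ext (by simpa using h)) γ
  exact eq_neg_of_add_eq_zero_left h2

end IsLieSuperalgebra

/-- The relation of a right representation, applied to vectors `F b` in any module. -/
theorem IsRightRep.sum_smul {n m : ℕ} {K W : Type*} [Field K] [AddCommGroup W] [Module K W]
    {C : Fin n → Fin n → Fin n → K} {k : Fin m → Fin n → Fin m → K} (h : IsRightRep C k)
    (F : Fin m → W) (a : Fin m) (μ ν : Fin n) :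
    ∑ c, k a μ c • ∑ b, k c ν b • F b - ∑ c, k a ν c • ∑ b, k c μ b • F b =
      ∑ γ, C μ ν γ • ∑ b, k a γ b • F b := by
  simp only [Finset.smul_sum, smul_smul]
  rw [Finset.sum_comm, Finset.sum_comm (f := fun c b => (k a ν c * k c μ b) • F b),
    Finset.sum_comm (f := fun γ b => (C μ ν γ * k a γ b) • F b)]
  simp only [← Finset.sum_smul, ← Finset.sum_sub_distrib, ← sub_smul, ← h a μ ν]

namespace ShiftBasis

variable {n m : ℕ} {K : Type*} [Field K] {C : Fin n → Fin n → Fin n → K}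
  {k : Fin m → Fin n → Fin m → K}

theorem table_skew (hC : ∀ μ ν γ, C μ ν γ = -C ν μ γ) (u v : ShiftBasis n m) :
    table C k u v = -((-1 : K) ^ (u.parity.val * v.parity.val) • table C k v u) := by
  have h1 : (1 : ZMod 2).val = 1 := rfl
  rcases u with μ | a | ⟨μ, ν⟩ | ⟨μ, a⟩ | ⟨a, b⟩ <;>
    rcases v with μ' | a' | ⟨μ', ν'⟩ | ⟨μ', a'⟩ | ⟨a', b'⟩ <;>
    simp only [table, parity, h1, ZMod.val_zero, mul_zero, mul_one, pow_zero, pow_one,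
      one_smul, neg_smul, smul_zero, neg_neg, neg_zero]
  rw [← Finset.sum_neg_distrib]
  exact Finset.sum_congr rfl fun γ _ => by rw [hC, Finsupp.single_neg]

theorem table_mem (u v : ShiftBasis n m) :
    table C k u v ∈ ShiftExt.grading n m K (u.parity + v.parity) := by
  have h : ∀ (p : ZMod 2) (ι : Type) [Fintype ι] (F : ι → ShiftBasis n m) (c : ι → K),
      (∀ i, (F i).parity = p) →
        ∑ i, Finsupp.single (F i) (c i) ∈ ShiftExt.grading n m K p := fun p ι _ F c hF =>
    Submodule.sum_mem _ fun i _ => Finsupp.single_mem_supported K _ (hF i)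
  rcases u with μ | a | ⟨μ, ν⟩ | ⟨μ, a⟩ | ⟨a, b⟩ <;>
    rcases v with μ' | a' | ⟨μ', ν'⟩ | ⟨μ', a'⟩ | ⟨a', b'⟩ <;>
    first
    | exact zero_mem _
    | exact h _ _ _ _ fun _ => rfl
    | exact neg_mem (h _ _ _ _ fun _ => rfl)

/-- The left side of the graded Jacobi identity for three basis elements. -/
def jacobiator (C : Fin n → Fin n → Fin n → K) (k : Fin m → Fin n → Fin m → K)
    (u v w : ShiftBasis n m) : ShiftExt n m K :=
  (-1 : K) ^ (u.parity.val * w.parity.val) •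
      Finsupp.linearCombination K (table C k u) (table C k v w) +
    (-1 : K) ^ (v.parity.val * u.parity.val) •
      Finsupp.linearCombination K (table C k v) (table C k w u) +
    (-1 : K) ^ (w.parity.val * v.parity.val) •
      Finsupp.linearCombination K (table C k w) (table C k u v)

theorem jacobiator_rotate (u v w : ShiftBasis n m) :
    jacobiator C k u v w = jacobiator C k v w u := by
  simp only [jacobiator]
  abel

theorem single_eq_smul (u : ShiftBasis n m) (c : K) :
    Finsupp.single u c = c • Finsupp.single u 1 := by
  rw [Finsupp.smul_single, smul_eq_mul, mul_one]

/-- The Jacobi identity for two `X`s and a member of a family of basis elements on which the `X`s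
act by a right representation. Each of `X`, `θ`, `T¹_{·ν}`, `T²_{·a}`, `T⁴_{·b}` is one. -/
theorem jacobiator_of_isRightRep {p : ℕ} {l : Fin p → Fin n → Fin p → K} (hl : IsRightRep C l)
    (F : Fin p → ShiftBasis n m)
    (h1 : ∀ a ν, table C k (F a) (X ν) = ∑ b, Finsupp.single (F b) (l a ν b))
    (h2 : ∀ a ν, table C k (X ν) (F a) = -∑ b, Finsupp.single (F b) (l a ν b))
    (a : Fin p) (μ ν : Fin n) : jacobiator C k (F a) (X μ) (X ν) = 0 := by
  have h := hl.sum_smul (fun b => (Finsupp.single (F b) 1 : ShiftExt n m K)) a μ ν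
  have hX : table C k (X μ) (X ν : ShiftBasis n m) = ∑ γ, Finsupp.single (X γ) (C μ ν γ) := rfl
  have hp : ∀ μ, (X μ : ShiftBasis n m).parity.val = 0 := fun _ => rfl
  simp only [jacobiator, hp, h1, h2, hX, map_neg, map_sum, Finsupp.linearCombination_single,
    mul_zero, zero_mul, pow_zero, one_smul, smul_neg, Finset.sum_neg_distrib, neg_neg]
  simp only [single_eq_smul _ (l _ _ _)]
  rw [← h]
  abel

/-- Up to rotation, the only nontrivial cases of the Jacobi identity with just one `X`: they express
that `[T²_{μa}, θ_b]` is equivariant. -/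
theorem jacobiator_X_θ_T2 (hk : IsRightRep C k) (lam μ : Fin n) (a b : Fin m) :
    jacobiator C k (X lam) (θ b) (T2 μ a) = 0 ∧ jacobiator C k (X lam) (T2 μ a) (θ b) = 0 := by
  have h := hk.sum_smul (fun c => (Finsupp.single (T4 c a) 1 : ShiftExt n m K)) b μ lam
  have hv : (1 : ZMod 2).val = 1 := rfl
  simp only [jacobiator, table, parity, hv, map_neg, map_sum, Finsupp.linearCombination_single,
    mul_zero, mul_one, pow_zero, pow_one, one_smul, neg_smul, smul_neg,
    Finset.sum_neg_distrib, neg_neg, ZMod.val_zero]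
  simp only [single_eq_smul _ (k _ _ _)]
  rw [← h]
  constructor <;> abel

theorem jacobiator_eq_zero (hC : ∀ μ ν γ, C μ ν γ = -C ν μ γ) (hCC : IsRightRep C C)
    (hk : IsRightRep C k) (u v w : ShiftBasis n m) : jacobiator C k u v w = 0 := by
  have hX : ∀ a μ ν, jacobiator C k (X a) (X μ) (X ν) = 0 := by
    refine jacobiator_of_isRightRep hCC X (fun _ _ => rfl) fun a ν => ?_
    rw [← Finset.sum_neg_distrib]
    exact Finset.sum_congr rfl fun γ _ => by rw [hC, Finsupp.single_neg]
  have hθ : ∀ a μ ν, jacobiator C k (θ a) (X μ) (X ν) = 0 :=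
    jacobiator_of_isRightRep hk θ (fun _ _ => rfl) fun _ _ => rfl
  have hT1 : ∀ σ a μ ν, jacobiator C k (T1 a σ) (X μ) (X ν) = 0 := fun σ =>
    jacobiator_of_isRightRep hCC (T1 · σ) (fun _ _ => rfl) fun _ _ => rfl
  have hT2 : ∀ a ρ μ ν, jacobiator C k (T2 ρ a) (X μ) (X ν) = 0 := fun a =>
    jacobiator_of_isRightRep hCC (T2 · a) (fun _ _ => rfl) fun _ _ => rfl
  have hT4 : ∀ a b μ ν, jacobiator C k (T4 b a) (X μ) (X ν) = 0 := fun a =>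
    jacobiator_of_isRightRep hk (T4 · a) (fun _ _ => rfl) fun _ _ => rfl
  have hXθ := fun lam μ a b => (jacobiator_X_θ_T2 hk lam μ a b).1
  have hXT := fun lam μ a b => (jacobiator_X_θ_T2 hk lam μ a b).2
  rcases u with μ | a | ⟨μ, ν⟩ | ⟨μ, a⟩ | ⟨a, b⟩ <;>
    rcases v with μ' | a' | ⟨μ', ν'⟩ | ⟨μ', a'⟩ | ⟨a', b'⟩ <;>
    rcases w with μ'' | a'' | ⟨μ'', ν''⟩ | ⟨μ'', a''⟩ | ⟨a'', b''⟩ <;>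
    first
    | with_reducible first
      | exact hX _ _ _
      | exact hθ _ _ _
      | exact hT1 _ _ _ _
      | exact hT2 _ _ _ _
      | exact hT4 _ _ _ _
      | exact hXθ _ _ _ _
      | exact hXT _ _ _ _
    | (rw [jacobiator_rotate]
       with_reducible first
       | exact hθ _ _ _
       | exact hT1 _ _ _ _
       | exact hT2 _ _ _ _
       | exact hT4 _ _ _ _
       | exact hXθ _ _ _ _
       | exact hXT _ _ _ _)
    | (rw [← jacobiator_rotate]
       with_reducible first
       | exact hθ _ _ _
       | exact hT1 _ _ _ _
       | exact hT2 _ _ _ _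
       | exact hT4 _ _ _ _
       | exact hXθ _ _ _ _
       | exact hXT _ _ _ _)
    | simp only [jacobiator, table, map_zero, map_neg, map_sum, Finsupp.linearCombination_single,
        smul_zero, neg_zero, Finset.sum_const_zero, add_zero]

end ShiftBasis

namespace ShiftExt

variable {n m : ℕ} {K : Type*} [Field K] {C : Fin n → Fin n → Fin n → K}
  {k : Fin m → Fin n → Fin m → K}

theorem bracket_single (u : ShiftBasis n m) :
    bracket C k (Finsupp.single u 1) = Finsupp.linearCombination K (ShiftBasis.table C k u) := by
  rw [bracket, Finsupp.linearCombination_single, one_smul]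

theorem bracket_single_single (u v : ShiftBasis n m) :
    bracket C k (Finsupp.single u 1) (Finsupp.single v 1) = ShiftBasis.table C k u v := by
  rw [bracket_single, Finsupp.linearCombination_single, one_smul]

/-- A linear condition on a homogeneous part of `g^L` may be checked on basis elements. -/
theorem mem_of_grading_of_single {i : ZMod 2} {p : Submodule K (ShiftExt n m K)}
    (h : ∀ u : ShiftBasis n m, u.parity = i → Finsupp.single u 1 ∈ p) {x : ShiftExt n m K}
    (hx : x ∈ grading n m K i) : x ∈ p := by
  rw [grading, Finsupp.supported_eq_span_single] at hx
  refine Submodule.span_le.2 ?_ hx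
  rintro _ ⟨u, hu, rfl⟩
  exact h u hu

theorem isInternal_grading : DirectSum.IsInternal (grading n m K) := by
  have hu : (Set.univ : Set (ZMod 2)) = {0, 1} := by
    ext i
    fin_cases i
    · exact iff_of_true trivial (Or.inl rfl)
    · exact iff_of_true trivial (Or.inr rfl)
  refine (DirectSum.isInternal_submodule_iff_isCompl _ zero_ne_one hu).2 ⟨?_, ?_⟩
  · refine Finsupp.disjoint_supported_supported ?_
    refine Set.disjoint_left.2 fun u h0 h1 => zero_ne_one (α := ZMod 2) (h0.symm.trans h1)
  · rw [codisjoint_iff, grading, grading, ← Finsupp.supported_union]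
    have : ({u | u.parity = 0} ∪ {u | u.parity = 1} : Set (ShiftBasis n m)) = Set.univ := by
      ext u
      cases u <;> simp [ShiftBasis.parity]
    rw [this, Finsupp.supported_univ]

theorem isLieSuperalgebra (hC : ∀ μ ν γ, C μ ν γ = -C ν μ γ) (hCC : IsRightRep C C)
    (hk : IsRightRep C k) : IsLieSuperalgebra (grading n m K) (bracket C k) where
  isInternal := isInternal_grading
  bracket_mem i j x hx y hy := by
    refine mem_of_grading_of_single (p := (grading n m K (i + j)).comap ((bracket C k).flip y))
      (fun u hu => ?_) hx
    refine mem_of_grading_of_single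
      (p := (grading n m K (i + j)).comap (bracket C k (Finsupp.single u 1))) (fun v hv => ?_) hy
    rw [Submodule.mem_comap, bracket_single_single, ← hu, ← hv]
    exact ShiftBasis.table_mem u v
  skew i j x hx y hy := by
    refine mem_of_grading_of_single (p := LinearMap.eqLocus ((bracket C k).flip y)
      (-((-1 : K) ^ (i.val * j.val) • bracket C k y))) (fun u hu => ?_) hx
    refine mem_of_grading_of_single (p := LinearMap.eqLocus (bracket C k (Finsupp.single u 1))
      (-((-1 : K) ^ (i.val * j.val) • (bracket C k).flip (Finsupp.single u 1))))
      (fun v hv => ?_) hy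
    rw [LinearMap.mem_eqLocus, LinearMap.neg_apply, LinearMap.smul_apply, LinearMap.flip_apply,
      bracket_single_single, bracket_single_single, ← hu, ← hv]
    exact ShiftBasis.table_skew hC u v
  jacobi i j l x hx y hy z hz := by
    have h1 : ∀ u v w : ShiftBasis n m, u.parity = i → v.parity = j → w.parity = l →
        (-1 : K) ^ (i.val * l.val) • bracket C k (Finsupp.single u 1)
            (bracket C k (Finsupp.single v 1) (Finsupp.single w 1)) +
          (-1 : K) ^ (j.val * i.val) • bracket C k (Finsupp.single v 1)
            (bracket C k (Finsupp.single w 1) (Finsupp.single u 1)) +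
          (-1 : K) ^ (l.val * j.val) • bracket C k (Finsupp.single w 1)
            (bracket C k (Finsupp.single u 1) (Finsupp.single v 1)) = 0 := by
      intro u v w hu hv hw
      have h := ShiftBasis.jacobiator_eq_zero hC hCC hk u v w
      rw [ShiftBasis.jacobiator, hu, hv, hw] at h
      rw [bracket_single_single, bracket_single_single, bracket_single_single, bracket_single,
        bracket_single, bracket_single]
      exact h
    have h2 : ∀ u v : ShiftBasis n m, u.parity = i → v.parity = j →
        (-1 : K) ^ (i.val * l.val) • bracket C k (Finsupp.single u 1)
            (bracket C k (Finsupp.single v 1) z) +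
          (-1 : K) ^ (j.val * i.val) • bracket C k (Finsupp.single v 1)
            (bracket C k z (Finsupp.single u 1)) +
          (-1 : K) ^ (l.val * j.val) • bracket C k z
            (bracket C k (Finsupp.single u 1) (Finsupp.single v 1)) = 0 := by
      intro u v hu hv
      have h := mem_of_grading_of_single (p := LinearMap.ker
        ((-1 : K) ^ (i.val * l.val) •
            bracket C k (Finsupp.single u 1) ∘ₗ bracket C k (Finsupp.single v 1) +
          (-1 : K) ^ (j.val * i.val) •
            bracket C k (Finsupp.single v 1) ∘ₗ (bracket C k).flip (Finsupp.single u 1) +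
          (-1 : K) ^ (l.val * j.val) • (bracket C k).flip
            (bracket C k (Finsupp.single u 1) (Finsupp.single v 1))))
        (fun w hw => LinearMap.mem_ker.2 (h1 u v w hu hv hw)) hz
      exact LinearMap.mem_ker.1 h
    have h3 : ∀ u : ShiftBasis n m, u.parity = i →
        (-1 : K) ^ (i.val * l.val) • bracket C k (Finsupp.single u 1) (bracket C k y z) +
          (-1 : K) ^ (j.val * i.val) • bracket C k y (bracket C k z (Finsupp.single u 1)) +
          (-1 : K) ^ (l.val * j.val) • bracket C k z (bracket C k (Finsupp.single u 1) y) = 0 := by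
      intro u hu
      have h := mem_of_grading_of_single (p := LinearMap.ker
        ((-1 : K) ^ (i.val * l.val) •
            bracket C k (Finsupp.single u 1) ∘ₗ (bracket C k).flip z +
          (-1 : K) ^ (j.val * i.val) • (bracket C k).flip (bracket C k z (Finsupp.single u 1)) +
          (-1 : K) ^ (l.val * j.val) • bracket C k z ∘ₗ bracket C k (Finsupp.single u 1)))
        (fun v hv => LinearMap.mem_ker.2 (h2 u v hu hv)) hy
      exact LinearMap.mem_ker.1 h
    have h := mem_of_grading_of_single (p := LinearMap.ker
      ((-1 : K) ^ (i.val * l.val) • (bracket C k).flip (bracket C k y z) +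
        (-1 : K) ^ (j.val * i.val) • bracket C k y ∘ₗ bracket C k z +
        (-1 : K) ^ (l.val * j.val) • bracket C k z ∘ₗ (bracket C k).flip y))
      (fun u hu => LinearMap.mem_ker.2 (h3 u hu)) hx
    exact LinearMap.mem_ker.1 h

end ShiftExt

/-! ### Commutators in the semicompleted Weyl superalgebra -/

namespace SemiWeyl

variable {n : ℕ} {K : Type*} [Field K]

/-- The map `f ↦ f(∂)`, as a linear map. -/
def seriesLinear (n : ℕ) (K : Type*) [Field K] : DSeries n K →ₗ[K] SemiWeyl n K where
  toFun := series
  map_add' f g := normal_injective (map_add MvPolynomial.C f g)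
  map_smul' c f := normal_injective (by
    have h : (MvPolynomial.C (c • f) : NormalOrdered n K) = c • MvPolynomial.C f := by
      ext β : 1
      rw [MvPolynomial.coeff_smul, MvPolynomial.coeff_C, MvPolynomial.coeff_C]
      split_ifs <;> simp
    exact h)

theorem series_sum {ι : Type*} (s : Finset ι) (f : ι → DSeries n K) :
    series (∑ i ∈ s, f i) = ∑ i ∈ s, series (f i) :=
  map_sum (seriesLinear n K) f s

theorem series_smul (c : K) (f : DSeries n K) : series (c • f) = c • series f :=
  (seriesLinear n K).map_smul c f

theorem series_sub (f g : DSeries n K) : series (f - g) = series f - series g :=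
  (seriesLinear n K).map_sub f g

theorem series_mul_comm (f g : DSeries n K) : series f * series g = series g * series f := by
  rw [← series_mul, mul_comm, series_mul]

variable [CharZero K]

/-- The realization `∑_α x_α ψ(ℂ)_{μα}` of the even element `X_μ` in the Weyl algebra. -/
def hatX (C : Fin n → Fin n → Fin n → K) (μ : Fin n) : SemiWeyl n K :=
  ∑ α, x α * series (matrixSeries (psiSeries K) (matC C) μ α)

variable {C : Fin n → Fin n → Fin n → K}

/-- The commutator with `∑_α x_α ψ(ℂ)_{μα}` differentiates along the vector field
`∑_α ψ(ℂ)_{μα} ∂/∂∂_α`. -/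
theorem series_mul_hatX (f : DSeries n K) (μ : Fin n) :
    series f * hatX C μ = hatX C μ * series f +
      series (∑ α, matrixSeries (psiSeries K) (matC C) μ α * MvPowerSeries.pderiv K α f) := by
  rw [hatX, Finset.mul_sum, Finset.sum_mul, series_sum, ← Finset.sum_add_distrib]
  refine Finset.sum_congr rfl fun α _ => ?_
  rw [← mul_assoc, series_mul_x, add_mul, mul_assoc, mul_assoc, series_mul_comm f, series_mul,
    series_mul_comm (MvPowerSeries.pderiv K α f)]

theorem hatX_mul_hatX (hC : ∀ μ ν γ, C μ ν γ = -C ν μ γ) (hCC : IsRightRep C C) (μ ν : Fin n) :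
    hatX C μ * hatX C ν - hatX C ν * hatX C μ = ∑ γ, C μ ν γ • hatX C γ := by
  have hψ := hCC.psi_bracket hC μ ν
  have h1 : ∀ μ ν : Fin n, hatX C μ * hatX C ν =
      ∑ α, x α * (hatX C ν * series (matrixSeries (psiSeries K) (matC C) μ α)) +
        ∑ α, x α * series (∑ β, matrixSeries (psiSeries K) (matC C) ν β *
          MvPowerSeries.pderiv K β (matrixSeries (psiSeries K) (matC C) μ α)) := by
    intro μ ν
    rw [← Finset.sum_add_distrib]
    conv_lhs => rw [hatX, Finset.sum_mul]
    refine Finset.sum_congr rfl fun α _ => ?_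
    rw [mul_assoc, series_mul_hatX, mul_add]
  -- The terms `x_α x_β ψ_{μα} ψ_{νβ}`, without derivatives, are symmetric in `μ` and `ν`.
  have h2 : ∑ α, x α * (hatX C ν * series (matrixSeries (psiSeries K) (matC C) μ α)) =
      ∑ α, x α * (hatX C μ * series (matrixSeries (psiSeries K) (matC C) ν α)) := by
    simp only [hatX, Finset.mul_sum, Finset.sum_mul]
    rw [Finset.sum_comm]
    refine Finset.sum_congr rfl fun α _ => Finset.sum_congr rfl fun β _ => ?_
    rw [mul_assoc, mul_assoc, ← mul_assoc (x β), ← mul_assoc (x α), x_mul_x, series_mul_comm]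
  rw [h1, h1 ν μ, h2, add_sub_add_left_eq_sub, ← Finset.sum_sub_distrib]
  simp only [hatX, Finset.smul_sum]
  rw [Finset.sum_comm]
  refine Finset.sum_congr rfl fun α _ => ?_
  rw [← mul_sub, ← series_sub, hψ, series_sum, Finset.mul_sum]
  exact Finset.sum_congr rfl fun γ _ => by rw [series_smul, mul_smul_comm]

end SemiWeyl

namespace CliffordPart

variable {n m : ℕ} {K : Type*} [Field K]

/-- The generator `ξ_a` of the Clifford algebra. -/
def ξ (a : Fin m) : CliffordPart m K :=
  CliffordAlgebra.ι (QuadraticForm.dualProd K (Fin m → K)) (0, Pi.single a 1)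

/-- The generator `q_a` of the Clifford algebra. -/
def q (a : Fin m) : CliffordPart m K :=
  CliffordAlgebra.ι (QuadraticForm.dualProd K (Fin m → K)) (LinearMap.proj a, 0)

theorem ξ_mul_ξ (a b : Fin m) : (ξ a * ξ b : CliffordPart m K) = -(ξ b * ξ a) := by
  have h : QuadraticMap.polar (QuadraticForm.dualProd K (Fin m → K)) (0, Pi.single a 1)
      (0, Pi.single b 1) = 0 := by
    simp [QuadraticMap.polar, QuadraticForm.dualProd]
  rw [eq_neg_iff_add_eq_zero, ξ, ξ, CliffordAlgebra.ι_mul_ι_add_swap, h, map_zero]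

theorem q_mul_q (a b : Fin m) : (q a * q b : CliffordPart m K) = -(q b * q a) := by
  have h : QuadraticMap.polar (QuadraticForm.dualProd K (Fin m → K)) (LinearMap.proj a, 0)
      (LinearMap.proj b, 0) = 0 := by
    simp [QuadraticMap.polar, QuadraticForm.dualProd]
  rw [eq_neg_iff_add_eq_zero, q, q, CliffordAlgebra.ι_mul_ι_add_swap, h, map_zero]

theorem q_mul_ξ (a b : Fin m) :
    (q a * ξ b : CliffordPart m K) = (if a = b then 1 else 0) - ξ b * q a := by
  have h : QuadraticMap.polar (QuadraticForm.dualProd K (Fin m → K)) (LinearMap.proj a, 0)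
      (0, Pi.single b 1) = if a = b then 1 else 0 := by
    simp [QuadraticMap.polar, QuadraticForm.dualProd, Pi.single_apply]
  rw [eq_sub_iff_add_eq, q, ξ, CliffordAlgebra.ι_mul_ι_add_swap, h]
  split_ifs <;> simp

theorem ξ_mem (a : Fin m) :
    (ξ a : CliffordPart m K) ∈ CliffordAlgebra.evenOdd (QuadraticForm.dualProd K (Fin m → K)) 1 :=
  CliffordAlgebra.ι_mem_evenOdd_one _ _

theorem q_mem (a : Fin m) :
    (q a : CliffordPart m K) ∈ CliffordAlgebra.evenOdd (QuadraticForm.dualProd K (Fin m → K)) 1 :=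
  CliffordAlgebra.ι_mem_evenOdd_one _ _

/-- The quadratic element `∑_{a,b} k_{bμa} ξ_a q_b`; its commutators with the `ξ_a` give the right
action `k_μ` up to sign. -/
def spin (k : Fin m → Fin n → Fin m → K) (μ : Fin n) : CliffordPart m K :=
  ∑ a, ∑ b, k b μ a • (ξ a * q b)

variable {k : Fin m → Fin n → Fin m → K}

theorem spin_mem (k : Fin m → Fin n → Fin m → K) (μ : Fin n) :
    spin k μ ∈ CliffordAlgebra.evenOdd (QuadraticForm.dualProd K (Fin m → K)) 0 :=
  Submodule.sum_mem _ fun _ _ => Submodule.sum_mem _ fun _ _ =>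
    Submodule.smul_mem _ _ (CliffordAlgebra.ι_mul_ι_mem_evenOdd_zero _ _ _)

theorem spin_mul_ξ (μ : Fin n) (c : Fin m) :
    spin k μ * ξ c = ξ c * spin k μ + ∑ a, k c μ a • ξ a := by
  have h : ∀ a b, ξ a * q b * ξ c =
      (ξ c * (ξ a * q b) + if b = c then ξ a else 0 : CliffordPart m K) := by
    intro a b
    rw [mul_assoc, q_mul_ξ, mul_sub, ← mul_assoc, ← mul_assoc, ξ_mul_ξ a c, neg_mul, sub_neg_eq_add,
      mul_ite, mul_one, mul_zero, add_comm]
  simp only [spin, Finset.sum_mul, Finset.mul_sum, smul_mul_assoc, mul_smul_comm, h, smul_add,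
    Finset.sum_add_distrib, smul_ite, smul_zero, Finset.sum_ite_eq', Finset.mem_univ, if_true]

theorem q_mul_spin (μ : Fin n) (c : Fin m) :
    q c * spin k μ = spin k μ * q c + ∑ b, k b μ c • q b := by
  have h : ∀ a b, q c * (ξ a * q b) =
      (ξ a * q b * q c + if c = a then q b else 0 : CliffordPart m K) := by
    intro a b
    rw [← mul_assoc, q_mul_ξ, sub_mul, mul_assoc, mul_assoc, q_mul_q c b, mul_neg, sub_neg_eq_add,
      ite_mul, one_mul, zero_mul, add_comm]
  simp only [spin, Finset.sum_mul, Finset.mul_sum, smul_mul_assoc, mul_smul_comm, h, smul_add,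
    Finset.sum_add_distrib, smul_ite, smul_zero]
  congr 1
  rw [Finset.sum_comm]
  simp

/-- The elements `-spin k μ` represent the Lie algebra with structure constants `C`. -/
theorem spin_mul_spin (hC : ∀ μ ν γ, C μ ν γ = -C ν μ γ) (hk : IsRightRep C k) (μ ν : Fin n) :
    spin k μ * spin k ν - spin k ν * spin k μ = -∑ γ, C μ ν γ • spin k γ := by
  have h : ∀ a b, spin k μ * (ξ a * q b) = ξ a * q b * spin k μ +
      (∑ c, k a μ c • (ξ c * q b) - ∑ c, k c μ b • (ξ a * q c)) := by
    intro a b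
    have h1 : spin k μ * q b = q b * spin k μ - ∑ c, k c μ b • q c := by
      rw [q_mul_spin, add_sub_cancel_right]
    rw [← mul_assoc, spin_mul_ξ, add_mul, mul_assoc, h1, mul_sub, ← mul_assoc, Finset.mul_sum,
      Finset.sum_mul]
    simp only [mul_smul_comm, smul_mul_assoc]
    abel
  have h2 : spin k μ * spin k ν - spin k ν * spin k μ =
      ∑ a, ∑ b, k b ν a • (∑ c, k a μ c • (ξ c * q b) - ∑ c, k c μ b • (ξ a * q c)) := by
    rw [sub_eq_iff_eq_add]
    conv_lhs => rw [spin.eq_def k ν]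
    conv_rhs => rw [spin.eq_def k ν]
    simp only [Finset.mul_sum, Finset.sum_mul, mul_smul_comm, h, smul_add, smul_mul_assoc,
      ← Finset.sum_add_distrib]
    exact Finset.sum_congr rfl fun a _ => Finset.sum_congr rfl fun b _ => add_comm _ _
  have h3 : ∑ a, ∑ b, k b ν a • ∑ c, k a μ c • (ξ c * q b : CliffordPart m K) =
      ∑ a, ∑ b, (∑ c, k b ν c * k c μ a) • (ξ a * q b) := by
    simp only [Finset.smul_sum, Finset.sum_smul, smul_smul]
    rw [Finset.sum_comm, Finset.sum_comm (f := fun a b => ∑ c, (k b ν c * k c μ a) • (ξ a * q b))]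
    exact Finset.sum_congr rfl fun b _ => Finset.sum_comm
  have h4 : ∑ a, ∑ b, k b ν a • ∑ c, k c μ b • (ξ a * q c : CliffordPart m K) =
      ∑ a, ∑ b, (∑ c, k b μ c * k c ν a) • (ξ a * q b) := by
    simp only [Finset.smul_sum, Finset.sum_smul, smul_smul]
    refine Finset.sum_congr rfl fun a _ => ?_
    rw [Finset.sum_comm]
    simp only [mul_comm]
  simp only [h2, smul_sub, Finset.sum_sub_distrib, h3, h4]
  simp only [← Finset.sum_sub_distrib, ← sub_smul, hk _ ν μ]
  simp only [spin, Finset.smul_sum, Finset.sum_smul, smul_smul, ← Finset.sum_neg_distrib]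
  rw [Finset.sum_comm (s := Finset.univ) (t := Finset.univ) (f := fun γ a =>
    ∑ b, -((C μ ν γ * k b γ a) • (ξ a * q b : CliffordPart m K)))]
  refine Finset.sum_congr rfl fun a _ => ?_
  rw [Finset.sum_comm]
  refine Finset.sum_congr rfl fun γ _ => Finset.sum_congr rfl fun b _ => ?_
  rw [hC ν μ γ, neg_mul, neg_smul]

end CliffordPart

/-! ### The realization -/

namespace SemiWeylSuper

variable {n m : ℕ} {K : Type*} [Field K]

theorem tmul_mem_grading {i : ZMod 2} (w : SemiWeyl n K) {c : CliffordPart m K}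
    (hc : c ∈ CliffordAlgebra.evenOdd (QuadraticForm.dualProd K (Fin m → K)) i) :
    w ⊗ₜ[K] c ∈ grading n m K i :=
  Submodule.subset_span ⟨w, c, hc, rfl⟩

theorem commute_series_tmul (f g : DSeries n K) (c : CliffordPart m K) :
    Commute (SemiWeyl.series f ⊗ₜ[K] (1 : CliffordPart m K)) (SemiWeyl.series g ⊗ₜ[K] c) := by
  rw [Commute, SemiconjBy, Algebra.TensorProduct.tmul_mul_tmul,
    Algebra.TensorProduct.tmul_mul_tmul, one_mul, mul_one, SemiWeyl.series_mul_comm]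

/-- `neg_mul` for the negation that instance search finds on `SemiWeylSuper n m K`: it agrees with
the one of the ring structure only after unfolding, so that `rw [neg_mul]` does not see it. -/
theorem neg_mul_eq (a b : SemiWeylSuper n m K) : -a * b = -(a * b) := neg_mul a b

/-- `mul_neg`, see `neg_mul_eq`. -/
theorem mul_neg_eq (a b : SemiWeylSuper n m K) : a * -b = -(a * b) := mul_neg a b

end SemiWeylSuper

section Realization

variable {n m : ℕ} {K : Type*} [Field K] [CharZero K] {C : Fin n → Fin n → Fin n → K}
  {k : Fin m → Fin n → Fin m → K}

theorem weylLinearBasis_X (C : Fin n → Fin n → Fin n → K) (k : Fin m → Fin n → Fin m → K)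
    (μ : Fin n) : weylLinearBasis C k (.X μ) =
      SemiWeyl.hatX C μ ⊗ₜ[K] 1 - 1 ⊗ₜ[K] CliffordPart.spin k μ := by
  rw [weylLinearBasis, SemiWeyl.hatX, CliffordPart.spin, TensorProduct.sum_tmul,
    TensorProduct.tmul_sum]
  congr 1
  · refine Finset.sum_congr rfl fun α _ => ?_
    rw [SemiWeylSuper.x, SemiWeylSuper.series, Algebra.TensorProduct.tmul_mul_tmul, one_mul]
  · refine Finset.sum_congr rfl fun a _ => ?_
    rw [TensorProduct.tmul_sum]
    refine Finset.sum_congr rfl fun b _ => ?_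
    rw [SemiWeylSuper.ξ, SemiWeylSuper.q, Algebra.TensorProduct.tmul_mul_tmul, one_mul,
      TensorProduct.tmul_smul]
    rfl

theorem weylLinearBasis_θ (C : Fin n → Fin n → Fin n → K) (k : Fin m → Fin n → Fin m → K)
    (a : Fin m) : weylLinearBasis C k (.θ a) = 1 ⊗ₜ[K] CliffordPart.ξ a := rfl

theorem weylLinearBasis_T1 (C : Fin n → Fin n → Fin n → K) (k : Fin m → Fin n → Fin m → K)
    (μ ν : Fin n) : weylLinearBasis C k (.T1 μ ν) =
      SemiWeyl.series (matrixSeries (PowerSeries.exp K) (matC C) μ ν) ⊗ₜ[K] 1 := rfl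

theorem weylLinearBasis_T2 (C : Fin n → Fin n → Fin n → K) (k : Fin m → Fin n → Fin m → K)
    (μ : Fin n) (a : Fin m) : weylLinearBasis C k (.T2 μ a) =
      -∑ b, SemiWeyl.series (∑ c, k b μ c • matrixSeries (PowerSeries.exp K) (matK k) c a) ⊗ₜ[K]
        CliffordPart.q b := by
  rw [weylLinearBasis]
  congr 1
  refine Finset.sum_congr rfl fun b _ => ?_
  rw [SemiWeyl.series_sum, TensorProduct.sum_tmul]
  refine Finset.sum_congr rfl fun c _ => ?_
  rw [SemiWeylSuper.series, SemiWeylSuper.q, Algebra.TensorProduct.tmul_mul_tmul, one_mul, mul_one,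
    SemiWeyl.series_smul, TensorProduct.smul_tmul']
  rfl

theorem weylLinearBasis_T4 (C : Fin n → Fin n → Fin n → K) (k : Fin m → Fin n → Fin m → K)
    (a b : Fin m) : weylLinearBasis C k (.T4 a b) =
      SemiWeyl.series (matrixSeries (PowerSeries.exp K) (matK k) a b) ⊗ₜ[K] 1 := rfl

theorem weylLinearBasis_mem (u : ShiftBasis n m) :
    weylLinearBasis C k u ∈ SemiWeylSuper.grading n m K u.parity := by
  have h1 : (1 : CliffordPart m K) ∈
      CliffordAlgebra.evenOdd (QuadraticForm.dualProd K (Fin m → K)) 0 :=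
    Submodule.one_le.1 (CliffordAlgebra.one_le_evenOdd_zero _)
  rcases u with μ | a | ⟨μ, ν⟩ | ⟨μ, a⟩ | ⟨a, b⟩
  · rw [weylLinearBasis_X]
    exact sub_mem (SemiWeylSuper.tmul_mem_grading _ h1)
      (SemiWeylSuper.tmul_mem_grading _ (CliffordPart.spin_mem k μ))
  · exact SemiWeylSuper.tmul_mem_grading _ (CliffordPart.ξ_mem a)
  · exact SemiWeylSuper.tmul_mem_grading _ h1
  · rw [weylLinearBasis_T2]
    exact neg_mem (sum_mem fun b _ => SemiWeylSuper.tmul_mem_grading _ (CliffordPart.q_mem b))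
  · exact SemiWeylSuper.tmul_mem_grading _ h1

/-- The commutator of `φ(X_λ)` with `f(∂) c` for `c` in the Clifford algebra. -/
theorem series_tmul_mul_X (f : DSeries n K) (c : CliffordPart m K) (lam : Fin n) :
    (SemiWeyl.series f ⊗ₜ[K] c) * weylLinearBasis C k (.X lam) -
        weylLinearBasis C k (.X lam) * (SemiWeyl.series f ⊗ₜ[K] c) =
      SemiWeyl.series (∑ α, matrixSeries (psiSeries K) (matC C) lam α *
        MvPowerSeries.pderiv K α f) ⊗ₜ[K] c -
      SemiWeyl.series f ⊗ₜ[K] (c * CliffordPart.spin k lam - CliffordPart.spin k lam * c) := by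
  rw [weylLinearBasis_X, mul_sub, sub_mul, Algebra.TensorProduct.tmul_mul_tmul,
    Algebra.TensorProduct.tmul_mul_tmul, Algebra.TensorProduct.tmul_mul_tmul,
    Algebra.TensorProduct.tmul_mul_tmul, mul_one, mul_one, one_mul, one_mul,
    SemiWeyl.series_mul_hatX, TensorProduct.add_tmul, TensorProduct.tmul_sub]
  abel

/-- The supercommutator relation of `φ(u)` and `φ(v)` for two basis elements. -/
def BracketRel (C : Fin n → Fin n → Fin n → K) (k : Fin m → Fin n → Fin m → K)
    (u v : ShiftBasis n m) : Prop :=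
  weylLinear C k (ShiftBasis.table C k u v) =
    weylLinearBasis C k u * weylLinearBasis C k v -
      (-1 : K) ^ (u.parity.val * v.parity.val) • (weylLinearBasis C k v * weylLinearBasis C k u)

theorem BracketRel.symm (hC : ∀ μ ν γ, C μ ν γ = -C ν μ γ) {u v : ShiftBasis n m}
    (h : BracketRel C k u v) : BracketRel C k v u := by
  rw [BracketRel] at h ⊢
  rw [ShiftBasis.table_skew hC, map_neg, map_smul, h, mul_comm v.parity.val, smul_sub, smul_smul,
    ← mul_pow, neg_one_mul, neg_neg, one_pow, one_smul, neg_sub]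

open ShiftBasis

theorem weylLinear_sum {ι : Type*} (s : Finset ι) (F : ι → ShiftBasis n m) (c : ι → K) :
    weylLinear C k (∑ i ∈ s, Finsupp.single (F i) (c i)) =
      ∑ i ∈ s, c i • weylLinearBasis C k (F i) := by
  simp only [map_sum, weylLinear, Finsupp.linearCombination_single]

theorem bracketRel_X_X (hC : ∀ μ ν γ, C μ ν γ = -C ν μ γ) (hCC : IsRightRep C C)
    (hk : IsRightRep C k) (μ ν : Fin n) : BracketRel C k (X μ) (X ν) := by
  have h1 := SemiWeyl.hatX_mul_hatX hC hCC μ ν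
  have h2 := CliffordPart.spin_mul_spin hC hk μ ν
  rw [BracketRel, table, weylLinear_sum]
  simp only [weylLinearBasis_X, parity, ZMod.val_zero, mul_zero, pow_zero, one_smul, mul_sub,
    sub_mul, Algebra.TensorProduct.tmul_mul_tmul, one_mul, mul_one, smul_sub,
    Finset.sum_sub_distrib]
  have h3 : ∑ γ, C μ ν γ • ((1 : SemiWeyl n K) ⊗ₜ[K] CliffordPart.spin k γ) =
      -(1 ⊗ₜ[K] (CliffordPart.spin k μ * CliffordPart.spin k ν) -
        1 ⊗ₜ[K] (CliffordPart.spin k ν * CliffordPart.spin k μ)) := by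
    rw [← TensorProduct.tmul_sub, h2, TensorProduct.tmul_neg, neg_neg, TensorProduct.tmul_sum]
    exact Finset.sum_congr rfl fun γ _ => (TensorProduct.tmul_smul _ _ _).symm
  rw [h3]
  simp only [TensorProduct.smul_tmul', ← TensorProduct.sum_tmul, ← h1, TensorProduct.sub_tmul]
  abel

theorem bracketRel_θ_X (a : Fin m) (lam : Fin n) : BracketRel C k (θ a) (X lam) := by
  have h1 := CliffordPart.spin_mul_ξ (k := k) lam a
  rw [BracketRel, table, weylLinear_sum]
  simp only [weylLinearBasis_X, weylLinearBasis_θ, parity, ZMod.val_zero, mul_zero, pow_zero,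
    one_smul, mul_sub, sub_mul, Algebra.TensorProduct.tmul_mul_tmul, one_mul, mul_one, h1,
    TensorProduct.tmul_add, TensorProduct.tmul_sum, TensorProduct.tmul_smul]
  abel

theorem bracketRel_θ_θ (a b : Fin m) : BracketRel C k (θ a) (θ b) := by
  have hv : (1 : ZMod 2).val = 1 := rfl
  rw [BracketRel, table, map_zero, weylLinearBasis_θ, weylLinearBasis_θ, parity, parity, hv,
    mul_one, pow_one, Algebra.TensorProduct.tmul_mul_tmul, Algebra.TensorProduct.tmul_mul_tmul,
    CliffordPart.ξ_mul_ξ a b, TensorProduct.tmul_neg, neg_one_smul, sub_neg_eq_add,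
    neg_add_cancel]

theorem bracketRel_T1_X (hCC : IsRightRep C C) (μ ν lam : Fin n) :
    BracketRel C k (T1 μ ν) (X lam) := by
  have h1 : ∑ α, matrixSeries (psiSeries K) (matC C) lam α *
      MvPowerSeries.pderiv K α (matrixSeries (PowerSeries.exp K) (matC C) μ ν) =
        ∑ ρ, C μ lam ρ • matrixSeries (PowerSeries.exp K) (matC C) ρ ν :=
    hCC.sum_psi_mul_pderiv_exp lam μ ν
  rw [BracketRel, table, weylLinear_sum, parity, parity, ZMod.val_zero, mul_zero, pow_zero,
    one_smul, weylLinearBasis_T1, series_tmul_mul_X, one_mul, mul_one, sub_self,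
    TensorProduct.tmul_zero, sub_zero, h1, SemiWeyl.series_sum, TensorProduct.sum_tmul]
  exact Finset.sum_congr rfl fun ρ _ => by
    rw [SemiWeyl.series_smul, ← TensorProduct.smul_tmul', weylLinearBasis_T1]

theorem bracketRel_T4_X (hk : IsRightRep C k) (a b : Fin m) (lam : Fin n) :
    BracketRel C k (T4 a b) (X lam) := by
  rw [BracketRel, table, weylLinear_sum, parity, parity, ZMod.val_zero, mul_zero, pow_zero,
    one_smul, weylLinearBasis_T4, series_tmul_mul_X, one_mul, mul_one, sub_self,
    TensorProduct.tmul_zero, sub_zero, hk.sum_psi_mul_pderiv_exp, SemiWeyl.series_sum,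
    TensorProduct.sum_tmul]
  exact Finset.sum_congr rfl fun ρ _ => by
    rw [SemiWeyl.series_smul, ← TensorProduct.smul_tmul', weylLinearBasis_T4]

theorem bracketRel_T2_X (hk : IsRightRep C k) (μ lam : Fin n) (a : Fin m) :
    BracketRel C k (T2 μ a) (X lam) := by
  have hD := hk.sum_psi_mul_pderiv_exp lam
  rw [BracketRel, table, weylLinear_sum, parity, parity, ZMod.val_zero, mul_zero, pow_zero,
    one_smul]
  simp only [weylLinearBasis_T2]
  set e := matrixSeries (PowerSeries.exp K) (matK k)
  rw [SemiWeylSuper.neg_mul_eq, SemiWeylSuper.mul_neg_eq, ← neg_sub', Finset.sum_mul,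
    Finset.mul_sum, ← Finset.sum_sub_distrib]
  have h1 : ∀ b, (SemiWeyl.series (∑ c, k b μ c • e c a) ⊗ₜ[K] CliffordPart.q b) *
        weylLinearBasis C k (.X lam) - weylLinearBasis C k (.X lam) *
          (SemiWeyl.series (∑ c, k b μ c • e c a) ⊗ₜ[K] CliffordPart.q b) =
      SemiWeyl.series (∑ c, k b μ c • ∑ d, k c lam d • e d a) ⊗ₜ[K] CliffordPart.q b -
        ∑ c, SemiWeyl.series (k c lam b • ∑ d, k b μ d • e d a) ⊗ₜ[K] CliffordPart.q c := by
    intro b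
    rw [series_tmul_mul_X, CliffordPart.q_mul_spin, add_sub_cancel_left, TensorProduct.tmul_sum]
    congr 3
    · simp only [map_sum, Derivation.map_smul, Finset.mul_sum, mul_smul_comm, ← hD, Finset.smul_sum]
      rw [Finset.sum_comm]
    · funext c
      rw [TensorProduct.tmul_smul, SemiWeyl.series_smul, TensorProduct.smul_tmul']
  have h2 : ∀ b, ∑ γ, C μ lam γ • ∑ c, k b γ c • e c a =
      ∑ c, k b μ c • ∑ d, k c lam d • e d a - ∑ c, k b lam c • ∑ d, k c μ d • e d a := fun b =>
    (hk.sum_smul (fun c => e c a) b μ lam).symm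
  rw [Finset.sum_congr rfl fun b _ => h1 b, Finset.sum_sub_distrib,
    Finset.sum_comm (f := fun b c =>
      SemiWeyl.series (k c lam b • ∑ d, k b μ d • e d a) ⊗ₜ[K] (CliffordPart.q c : CliffordPart m K)),
    ← Finset.sum_sub_distrib]
  simp only [smul_neg, Finset.sum_neg_distrib, Finset.smul_sum (s := Finset.univ)
    (f := fun b => SemiWeyl.series _ ⊗ₜ[K] CliffordPart.q b)]
  rw [Finset.sum_comm]
  congr 1
  refine Finset.sum_congr rfl fun b _ => ?_
  rw [← TensorProduct.sum_tmul, ← TensorProduct.sub_tmul, ← SemiWeyl.series_sum,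
    ← SemiWeyl.series_sub, ← h2, SemiWeyl.series_sum, TensorProduct.sum_tmul]
  exact Finset.sum_congr rfl fun γ _ => by rw [SemiWeyl.series_smul, TensorProduct.smul_tmul']

theorem bracketRel_T1_θ (μ ν : Fin n) (a : Fin m) : BracketRel C k (T1 μ ν) (θ a) := by
  rw [BracketRel, table, map_zero, weylLinearBasis_θ, weylLinearBasis_T1,
    show (T1 μ ν).parity.val = 0 from rfl, zero_mul, pow_zero, one_smul,
    Algebra.TensorProduct.tmul_mul_tmul, Algebra.TensorProduct.tmul_mul_tmul, one_mul, mul_one,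
    one_mul, mul_one, sub_self]

theorem bracketRel_T4_θ (a b c : Fin m) : BracketRel C k (T4 a b) (θ c) := by
  rw [BracketRel, table, map_zero, weylLinearBasis_θ, weylLinearBasis_T4,
    show (T4 a b).parity.val = 0 from rfl, zero_mul, pow_zero, one_smul,
    Algebra.TensorProduct.tmul_mul_tmul, Algebra.TensorProduct.tmul_mul_tmul, one_mul, mul_one,
    one_mul, mul_one, sub_self]

theorem bracketRel_T2_θ (μ : Fin n) (a b : Fin m) : BracketRel C k (T2 μ a) (θ b) := by
  have hv : (1 : ZMod 2).val = 1 := rfl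
  rw [BracketRel, table, map_neg, weylLinear_sum, weylLinearBasis_θ, weylLinearBasis_T2, parity,
    parity, hv, mul_one, pow_one, neg_one_smul, sub_neg_eq_add,
    SemiWeylSuper.neg_mul_eq, SemiWeylSuper.mul_neg_eq, ← neg_add,
    Finset.sum_mul, Finset.mul_sum, ← Finset.sum_add_distrib]
  congr 1
  have h : ∀ d, (SemiWeyl.series (∑ c, k d μ c • matrixSeries (PowerSeries.exp K) (matK k) c a)
        ⊗ₜ[K] CliffordPart.q d) * (1 ⊗ₜ[K] CliffordPart.ξ b) + (1 ⊗ₜ[K] CliffordPart.ξ b) *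
          (SemiWeyl.series (∑ c, k d μ c • matrixSeries (PowerSeries.exp K) (matK k) c a)
            ⊗ₜ[K] CliffordPart.q d) =
      if d = b then SemiWeyl.series (∑ c, k d μ c • matrixSeries (PowerSeries.exp K) (matK k) c a)
        ⊗ₜ[K] (1 : CliffordPart m K) else 0 := by
    intro d
    rw [Algebra.TensorProduct.tmul_mul_tmul, Algebra.TensorProduct.tmul_mul_tmul, one_mul, mul_one,
      ← TensorProduct.tmul_add, CliffordPart.q_mul_ξ, sub_add_cancel]
    split_ifs
    · rfl
    · rw [TensorProduct.tmul_zero]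
  rw [Finset.sum_congr rfl fun d _ => h d, Finset.sum_ite_eq' Finset.univ b,
    if_pos (Finset.mem_univ b),
    SemiWeyl.series_sum, TensorProduct.sum_tmul]
  exact Finset.sum_congr rfl fun c _ => by
    rw [SemiWeyl.series_smul, ← TensorProduct.smul_tmul', weylLinearBasis_T4]

theorem bracketRel_of_commute {u v : ShiftBasis n m} (ht : table C k u v = 0)
    (hp : u.parity.val * v.parity.val = 0)
    (h : Commute (weylLinearBasis C k u) (weylLinearBasis C k v)) : BracketRel C k u v := by
  rw [BracketRel, ht, map_zero, hp, pow_zero, one_smul, h.eq, sub_self]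

theorem commute_series_T2 (f : DSeries n K) (μ : Fin n) (a : Fin m) :
    Commute (SemiWeyl.series f ⊗ₜ[K] (1 : CliffordPart m K)) (weylLinearBasis C k (T2 μ a)) := by
  rw [weylLinearBasis_T2]
  exact (Commute.sum_right _ _ _ fun b _ => SemiWeylSuper.commute_series_tmul _ _ _).neg_right

theorem bracketRel_T2_T2 (μ ν : Fin n) (a b : Fin m) : BracketRel C k (T2 μ a) (T2 ν b) := by
  have hv : (1 : ZMod 2).val = 1 := rfl
  rw [BracketRel, table, map_zero, weylLinearBasis_T2, weylLinearBasis_T2, parity, parity, hv,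
    mul_one, pow_one, neg_one_smul, sub_neg_eq_add,
    SemiWeylSuper.neg_mul_eq, SemiWeylSuper.neg_mul_eq, SemiWeylSuper.mul_neg_eq,
    SemiWeylSuper.mul_neg_eq, neg_neg, neg_neg, Finset.sum_mul_sum,
    Finset.sum_mul_sum, Finset.sum_comm, ← Finset.sum_add_distrib]
  refine (Finset.sum_eq_zero fun c _ => ?_).symm
  rw [← Finset.sum_add_distrib]
  refine Finset.sum_eq_zero fun d _ => ?_
  rw [Algebra.TensorProduct.tmul_mul_tmul, Algebra.TensorProduct.tmul_mul_tmul,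
    CliffordPart.q_mul_q d c, SemiWeyl.series_mul_comm, TensorProduct.tmul_neg, neg_add_cancel]

theorem bracketRel (hC : ∀ μ ν γ, C μ ν γ = -C ν μ γ) (hCC : IsRightRep C C)
    (hk : IsRightRep C k) (u v : ShiftBasis n m) : BracketRel C k u v := by
  rcases u with μ | a | ⟨μ, ν⟩ | ⟨μ, a⟩ | ⟨a, b⟩ <;>
    rcases v with μ' | a' | ⟨μ', ν'⟩ | ⟨μ', a'⟩ | ⟨a', b'⟩
  · exact bracketRel_X_X hC hCC hk μ μ'
  · exact (bracketRel_θ_X a' μ).symm hC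
  · exact (bracketRel_T1_X hCC μ' ν' μ).symm hC
  · exact (bracketRel_T2_X hk μ' μ a').symm hC
  · exact (bracketRel_T4_X hk a' b' μ).symm hC
  · exact bracketRel_θ_X a μ'
  · exact bracketRel_θ_θ a a'
  · exact (bracketRel_T1_θ μ' ν' a).symm hC
  · exact (bracketRel_T2_θ μ' a' a).symm hC
  · exact (bracketRel_T4_θ a' b' a).symm hC
  · exact bracketRel_T1_X hCC μ ν μ'
  · exact bracketRel_T1_θ μ ν a'
  · exact bracketRel_of_commute rfl rfl (SemiWeylSuper.commute_series_tmul _ _ _)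
  · exact bracketRel_of_commute rfl rfl (commute_series_T2 _ μ' a')
  · exact bracketRel_of_commute rfl rfl (SemiWeylSuper.commute_series_tmul _ _ _)
  · exact bracketRel_T2_X hk μ μ' a
  · exact bracketRel_T2_θ μ a a'
  · exact bracketRel_of_commute rfl rfl (commute_series_T2 _ μ a).symm
  · exact bracketRel_T2_T2 μ μ' a a'
  · exact bracketRel_of_commute rfl rfl (commute_series_T2 _ μ a).symm
  · exact bracketRel_T4_X hk a b μ'
  · exact bracketRel_T4_θ a b a'
  · exact bracketRel_of_commute rfl rfl (SemiWeylSuper.commute_series_tmul _ _ _)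
  · exact bracketRel_of_commute rfl rfl (commute_series_T2 _ μ' a')
  · exact bracketRel_of_commute rfl rfl (SemiWeylSuper.commute_series_tmul _ _ _)

theorem weylLinear_single (u : ShiftBasis n m) :
    weylLinear C k (Finsupp.single u 1) = weylLinearBasis C k u := by
  rw [weylLinear, Finsupp.linearCombination_single, one_smul]

theorem isRealization_weylLinear (hC : ∀ μ ν γ, C μ ν γ = -C ν μ γ) (hCC : IsRightRep C C)
    (hk : IsRightRep C k) :
    IsRealization (ShiftExt.grading n m K) (ShiftExt.bracket C k) (SemiWeylSuper.grading n m K)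
      (weylLinear C k) where
  map_mem i x hx := by
    refine ShiftExt.mem_of_grading_of_single
      (p := (SemiWeylSuper.grading n m K i).comap (weylLinear C k)) (fun u hu => ?_) hx
    rw [Submodule.mem_comap, weylLinear_single, ← hu]
    exact weylLinearBasis_mem u
  map_bracket i j x hx y hy := by
    have h1 : ∀ u : ShiftBasis n m, u.parity = i →
        weylLinear C k (ShiftExt.bracket C k (Finsupp.single u 1) y) =
          weylLinearBasis C k u * weylLinear C k y -
            (-1 : K) ^ (i.val * j.val) • (weylLinear C k y * weylLinearBasis C k u) := by
      intro u hu
      have h := ShiftExt.mem_of_grading_of_single (p := LinearMap.eqLocus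
        (weylLinear C k ∘ₗ ShiftExt.bracket C k (Finsupp.single u 1))
        (LinearMap.mulLeft K (weylLinearBasis C k u) ∘ₗ weylLinear C k - (-1 : K) ^ (i.val * j.val) •
          LinearMap.mulRight K (weylLinearBasis C k u) ∘ₗ weylLinear C k)) (fun v hv => ?_) hy
      · exact h
      · have hb := bracketRel hC hCC hk u v
        rw [BracketRel, hu, hv, ← weylLinear_single v, ← ShiftExt.bracket_single_single] at hb
        exact hb
    have h := ShiftExt.mem_of_grading_of_single (p := LinearMap.eqLocus
      (weylLinear C k ∘ₗ (ShiftExt.bracket C k).flip y)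
      (LinearMap.mulRight K (weylLinear C k y) ∘ₗ weylLinear C k - (-1 : K) ^ (i.val * j.val) •
        LinearMap.mulLeft K (weylLinear C k y) ∘ₗ weylLinear C k)) (fun u hu => ?_) hx
    · exact h
    · have h2 := h1 u hu
      rw [← weylLinear_single u] at h2
      exact h2

end Realization

end

theorem theorem2 {𝕂 : Type*} [RCLike 𝕂] {n m : ℕ} {V : Type*} [AddCommGroup V] [Module 𝕂 V]
    (g : ZMod 2 → Submodule 𝕂 V) (br : V →ₗ[𝕂] V →ₗ[𝕂] V) (hg : IsLieSuperalgebra g br)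
    (X : Module.Basis (Fin n) 𝕂 (g 0)) (θ : Module.Basis (Fin m) 𝕂 (g 1))
    (C : Fin n → Fin n → Fin n → 𝕂) (K : Fin m → Fin n → Fin m → 𝕂)
    (hXX : ∀ μ ν, br (X μ) (X ν) = ∑ α, C μ ν α • (X α : V))
    (hθX : ∀ a ν, br (θ a) (X ν) = ∑ b, K a ν b • (θ b : V))
    (hθθ : ∀ a b, br (θ a) (θ b) = 0) :
    IsLieSuperalgebra (ShiftExt.grading n m 𝕂) (ShiftExt.bracket C K) ∧
      IsRealization (ShiftExt.grading n m 𝕂) (ShiftExt.bracket C K)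
        (SemiWeylSuper.grading n m 𝕂) (weylLinear C K) := by
  have hC := hg.structureConstants_antisymm X hXX
  have hCC := hg.isRightRep X X hXX hXX
  have hk := hg.isRightRep X θ hXX hθX
  exact ⟨ShiftExt.isLieSuperalgebra hC hCC hk, isRealization_weylLinear hC hCC hk⟩
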